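/- Consider the class of real partial differential equations $$u_t+Auu_{xxx}+Bu_xu_{xx}+Cu^2u_x+u_{xxxxx}=0 \qquad (\mathcal L_\theta)$$ for $u=u(t,x)$, with arbitrary elements $\theta=(A,B,C)$ running through the set $\mathcal S$ of triples of nonzero real constants. A point transformation is a smooth diffeomorphism $\varphi$ from a nonempty connected open set of the space of the variables $(t,x,u)$ onto an open set of this space. It maps $\mathcal L_\theta$ to $\mathcal L_{\tilde\theta}$ if its prolongation to the fifth-order jet space does so, i.e., whenever $\varphi$ takes the graph of a smooth function $u$ near a point $(t,x)$ to the graph of a smooth function $\tilde u$ near a point $(\tilde t,\tilde x)$, then $u$ satisfies $\mathcal L_\theta$ at $(t,x)$ if and only if $\tilde u$ satisfies $\mathcal L_{\tilde\theta}$ at $(\tilde t,\tilde x)$. An admissible transformation of the class is a triple $(\theta,\tilde\theta,\varphi)$ with $\theta,\tilde\theta\in\mathcal S$ and $\varphi$ a point transformation that maps $\mathcal L_\theta$ to $\mathcal L_{\tilde\theta}$; the admissible transformations form the equivalence groupoid. The usual equivalence group consists of the smooth diffeomorphisms, in the joint space of $(t,x,u)$ and $(A,B,C)$, from $\Omega\times\mathcal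 S$ onto $\tilde\Omega\times\mathcal S$ whose $(t,x,u)$-components do not depend on $(A,B,C)$ and form a point transformation $\varphi$ from $\Omega$ onto $\tilde\Omega$, and which take every constant triple $\theta\in\mathcal S$ to a constant triple $\tilde\theta\in\mathcal S$ such that $\varphi$ maps $\mathcal L_\theta$ to $\mathcal L_{\tilde\theta}$. The usual equivalence group of this class consists exactly of the transformations (on connected open domains $\Omega$ of the variables, with $\Omega=\mathbb R^3$ possible for all parameter values) $$\tilde t=\beta^5t+\delta,\quad \tilde x=\beta x+\gamma,\quad \tilde u=\frac{u}{\beta^2\lambda},\quad \tilde A=\lambda A,\quad \tilde B=\lambda B,\quad \tilde C=\lambda^2C,$$ where $\beta,\gamma,\delta,\lambda$ are arbitrary real constants with $\beta\lambda\ne0$; they are closed under inversion and under composition (of transformations such that the image of the first is the domain of the second). This group generates the entire equivalence groupoid: a triple $(\theta,\tilde\theta,\varphi)$ with $\theta\in\mathcal S$ and $\varphi$ a point transformation is an admissible transformation if and only if it is induced by an element of the group, i.e., some element takes $((t,x,u),\theta)$ to $(\varphi(t,x,u),\tilde\theta)$ for all $(t,x,u)$ in the domain of $\varphi$. That is, the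 class is normalized in the usual sense. -/

import Mathlib

open scoped ContDiff Topology

namespace FifthKdV

/-- The space of the independent variables `(t, x)`. -/
abbrev Base : Type := ℝ × ℝ

/-- The space of the variables `(t, x, u)`, written as `((t, x), u)`. -/
abbrev Vars : Type := Base × ℝ

/-- The space of the coefficient triples `(A, B, C)`. -/
abbrev Coeffs : Type := ℝ × ℝ × ℝ

/-- The set through which the arbitrary elements `(A, B, C)` of the class run:
all three constants are nonzero. -/
def arbitraryElements : Set Coeffs := {θ | θ.1 ≠ 0 ∧ θ.2.1 ≠ 0 ∧ θ.2.2 ≠ 0}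

/-- The derivative `u_t` at the point `p = (t, x)`. -/
noncomputable def dt (u : Base → ℝ) (p : Base) : ℝ := deriv (fun s => u (s, p.2)) p.1

/-- The `k`-th derivative of `u` with respect to `x` at the point `p = (t, x)`. -/
noncomputable def dx (k : ℕ) (u : Base → ℝ) (p : Base) : ℝ :=
  iteratedDeriv k (fun y => u (p.1, y)) p.2

/-- The jet of `u` at the point `p` lies on the equation
`u_t + A u u_xxx + B u_x u_xx + C u² u_x + u_xxxxx = 0`, where `θ = (A, B, C)`. -/
def SatisfiesAt (θ : Coeffs) (u : Base → ℝ) (p : Base) : Prop :=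
  dt u p + θ.1 * u p * dx 3 u p + θ.2.1 * dx 1 u p * dx 2 u p + θ.2.2 * u p ^ 2 * dx 1 u p
    + dx 5 u p = 0

/-- A homeomorphism between open sets that is smooth together with its inverse. -/
structure IsLocalDiffeo {V : Type*} [NormedAddCommGroup V] [NormedSpace ℝ V]
    (Φ : OpenPartialHomeomorph V V) : Prop where
  contDiffOn : ContDiffOn ℝ ∞ Φ Φ.source
  contDiffOn_symm : ContDiffOn ℝ ∞ Φ.symm Φ.target

/-- A point transformation of `(t, x, u)`: a diffeomorphism from a nonempty connected open set
onto an open set of the space of variables. -/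
structure IsPointTransformation (φ : OpenPartialHomeomorph Vars Vars) : Prop where
  isLocalDiffeo : IsLocalDiffeo φ
  isConnected_source : IsConnected φ.source

/-- The transformation `φ` maps the germ of the smooth function `u` at `p` to the germ of the
smooth function `v` at `q`: it takes the graph of `u` near `p` to the graph of `v` near `q`.
The prolongation of `φ` to jets takes the jet of `u` at `p` to the jet of `v` at `q`, and every
pair of jets that correspond to each other arises in this way. -/
structure TransformsGerm (φ : OpenPartialHomeomorph Vars Vars)
    (u : Base → ℝ) (p : Base) (v : Base → ℝ) (q : Base) : Prop where
  smooth_left : ContDiffAt ℝ ∞ u p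
  smooth_right : ContDiffAt ℝ ∞ v q
  mem_source : (p, u p) ∈ φ.source
  map_point : φ (p, u p) = (q, v q)
  map_graph : ∀ᶠ r in 𝓝 p, v (φ (r, u r)).1 = (φ (r, u r)).2

/-- The prolongation of `φ` maps the equation with coefficients `θ` (as a submanifold of the
fifth-order jet space) to the equation with coefficients `θ'`. -/
def MapsEquation (φ : OpenPartialHomeomorph Vars Vars) (θ θ' : Coeffs) : Prop :=
  ∀ (u : Base → ℝ) (p : Base) (v : Base → ℝ) (q : Base),
    TransformsGerm φ u p v q → (SatisfiesAt θ u p ↔ SatisfiesAt θ' v q)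

/-- The triple `(θ, θ', φ)` is an admissible transformation of the class, i.e., an element of
its equivalence groupoid. -/
structure IsAdmissible (θ θ' : Coeffs) (φ : OpenPartialHomeomorph Vars Vars) : Prop where
  mem_left : θ ∈ arbitraryElements
  mem_right : θ' ∈ arbitraryElements
  isPointTransformation : IsPointTransformation φ
  mapsEquation : MapsEquation φ θ θ'

/-- `Ψ` is an element of the usual equivalence group of the class: a point transformation of the
joint space of the variables `(t, x, u)` and the arbitrary elements `(A, B, C)` that is
projectable to a point transformation `φ` of the variables, maps the set of arbitrary elements
onto itself, turns each constant tuple `θ` of arbitrary elements into a constant tuple `θ'`, and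
for these tuples maps the equation with coefficients `θ` to the one with coefficients `θ'`. -/
def IsUsualEquivalence (Ψ : OpenPartialHomeomorph (Vars × Coeffs) (Vars × Coeffs)) : Prop :=
  IsLocalDiffeo Ψ ∧
    ∃ φ : OpenPartialHomeomorph Vars Vars,
      IsPointTransformation φ ∧
      Ψ.source = φ.source ×ˢ arbitraryElements ∧
      Ψ.target = φ.target ×ˢ arbitraryElements ∧
      (∀ w ∈ Ψ.source, (Ψ w).1 = φ w.1) ∧
      ∀ θ ∈ arbitraryElements, ∃ θ' ∈ arbitraryElements,
        (∀ z ∈ φ.source, (Ψ (z, θ)).2 = θ') ∧ MapsEquation φ θ θ'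

/-- The admissible transformation `(θ, θ', φ)` is induced by the transformation `Ψ` of the joint
space: on the domain of `φ`, the transformation `Ψ` takes `((t, x, u), θ)` to `(φ (t, x, u), θ')`.
-/
def IsInducedBy (θ θ' : Coeffs) (φ : OpenPartialHomeomorph Vars Vars)
    (Ψ : OpenPartialHomeomorph (Vars × Coeffs) (Vars × Coeffs)) : Prop :=
  φ.source ×ˢ arbitraryElements ⊆ Ψ.source ∧ ∀ z ∈ φ.source, Ψ (z, θ) = (φ z, θ')

/-- The transformation `t ↦ β⁵ t + δ`, `x ↦ β x + γ`, `u ↦ u / (β² l)`, `A ↦ l A`, `B ↦ l B`,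
`C ↦ l² C` of the joint space. -/
noncomputable def scaling (β γ δ l : ℝ) (w : Vars × Coeffs) : Vars × Coeffs :=
  (((β ^ 5 * w.1.1.1 + δ, β * w.1.1.2 + γ), w.1.2 / (β ^ 2 * l)),
    (l * w.2.1, l * w.2.2.1, l ^ 2 * w.2.2.2))

end FifthKdV

namespace FifthKdV

open Filter Asymptotics

/-! ### Affine substitutions in derivatives -/

/-! Write `φ = (T, X, U)`. No prolongation formula is computed. Instead, two polynomial functions
`u`, `u₁` through the same point are chosen, both satisfying the source equation there, with a
difference `w` that is small in a prescribed way. Since `φ` is a diffeomorphism, the transformed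
functions differ by `κ w`, `κ ≠ 0`, up to smaller terms, where `w` is pulled back to the new
independent variables (`TransformsGerm.sub_isLittleO`). Both transformed functions satisfy the
target equation, and subtracting the two instances isolates one relation between derivatives of `φ`.

The choices of `w`, with base point at the origin, are as follows. `t ^ 5` is invisible to the
source, but would create a fifth `X`-derivative unless `T` is free of `x` and `u`
(`fderiv_t_eq_zero`). `t - x ^ 5 / 120` balances `u_t` against `u_xxxxx`; it gives `T_t = X_x ^ 5`
and `X_u = 0` (`fderiv_x_eq`). `x ^ 4` is absent from both equations, so the next term of its image
must vanish, which makes `U_u` constant at fixed `t` (`fderiv_fderiv_u_along`). `x ^ 3`, compensated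
by `u_t`, gives `A' X_x ^ 2 U = A u` (`u_eq`).

Now `U` is proportional to `u` at fixed `t`, and quadratic polynomials in `x` give `B A' = B' A`
together with a formula for `X_t` that is quadratic in `u` (`coeff_relation`). As `X_t` cannot
depend on `u`, this forces `C' A ^ 2 = C A' ^ 2` and `X_t = 0`. Hence `X_x` is locally constant, and
connectedness yields one global scaling with `λ = A' / A` (`exists_scaling_of_mapsEquation`). The
statements about the group and the groupoid follow from this classification. -/

lemma iteratedDeriv_comp_affine (f : ℝ → ℝ) (β γ : ℝ) (k : ℕ) :
    iteratedDeriv k (fun x => f (β * x + γ)) =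
      fun x => β ^ k * iteratedDeriv k f (β * x + γ) := by
  induction k with
  | zero => simp
  | succ k ih =>
    rw [iteratedDeriv_succ, ih]
    funext x
    rw [deriv_const_mul_field,
      deriv_comp_mul_left β (fun y => iteratedDeriv k f (y + γ)) x, deriv_comp_add_const,
      iteratedDeriv_succ, smul_eq_mul]
    ring

lemma deriv_comp_affine (f : ℝ → ℝ) (β γ x : ℝ) :
    deriv (fun x => f (β * x + γ)) x = β * deriv f (β * x + γ) := by
  have h := congrFun (iteratedDeriv_comp_affine f β γ 1) x
  simpa using h

/-! ### The scalings of the variables and of the coefficients -/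

/-- The action of a scaling on the variables `(t, x, u)`. -/
noncomputable def varScaling (β γ δ l : ℝ) (z : Vars) : Vars :=
  ((β ^ 5 * z.1.1 + δ, β * z.1.2 + γ), z.2 / (β ^ 2 * l))

/-- The action of a scaling on the coefficients `(A, B, C)`. -/
def coeffScaling (l : ℝ) (θ : Coeffs) : Coeffs := (l * θ.1, l * θ.2.1, l ^ 2 * θ.2.2)

lemma scaling_eq (β γ δ l : ℝ) (w : Vars × Coeffs) :
    scaling β γ δ l w = (varScaling β γ δ l w.1, coeffScaling l w.2) := rfl

lemma varScaling_comp (β γ δ l β' γ' δ' l' : ℝ) (z : Vars) :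
    varScaling β' γ' δ' l' (varScaling β γ δ l z) =
      varScaling (β' * β) (β' * γ + γ') (β' ^ 5 * δ + δ') (l' * l) z := by
  refine Prod.ext (Prod.ext ?_ ?_) ?_ <;> simp only [varScaling]
  · ring
  · ring
  · rw [div_div]; congr 1; ring

lemma varScaling_one (z : Vars) : varScaling 1 0 0 1 z = z := by
  simp [varScaling]

lemma coeffScaling_comp (l l' : ℝ) (θ : Coeffs) :
    coeffScaling l' (coeffScaling l θ) = coeffScaling (l' * l) θ := by
  refine Prod.ext ?_ (Prod.ext ?_ ?_) <;> simp only [coeffScaling] <;> ring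

lemma coeffScaling_one (θ : Coeffs) : coeffScaling 1 θ = θ := by
  simp [coeffScaling]

lemma coeffScaling_mem {l : ℝ} (hl : l ≠ 0) {θ : Coeffs} (hθ : θ ∈ arbitraryElements) :
    coeffScaling l θ ∈ arbitraryElements :=
  ⟨mul_ne_zero hl hθ.1, mul_ne_zero hl hθ.2.1, mul_ne_zero (pow_ne_zero _ hl) hθ.2.2⟩

lemma varScaling_left_inv {β l : ℝ} (hβ : β ≠ 0) (hl : l ≠ 0) (γ δ : ℝ) (z : Vars) :
    varScaling β⁻¹ (-(β⁻¹ * γ)) (-(β⁻¹ ^ 5 * δ)) l⁻¹ (varScaling β γ δ l z) = z := by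
  rw [varScaling_comp, inv_mul_cancel₀ hβ, inv_mul_cancel₀ hl, add_neg_cancel, add_neg_cancel,
    varScaling_one]

lemma varScaling_right_inv {β l : ℝ} (hβ : β ≠ 0) (hl : l ≠ 0) (γ δ : ℝ) (z : Vars) :
    varScaling β γ δ l (varScaling β⁻¹ (-(β⁻¹ * γ)) (-(β⁻¹ ^ 5 * δ)) l⁻¹ z) = z := by
  have h1 : β * -(β⁻¹ * γ) + γ = 0 := by field_simp; ring
  have h2 : β ^ 5 * -(β⁻¹ ^ 5 * δ) + δ = 0 := by field_simp; ring
  rw [varScaling_comp, mul_inv_cancel₀ hβ, mul_inv_cancel₀ hl, h1, h2, varScaling_one]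

lemma contDiff_varScaling (β γ δ l : ℝ) : ContDiff ℝ ∞ (varScaling β γ δ l) := by
  unfold varScaling; fun_prop

lemma contDiff_coeffScaling (l : ℝ) : ContDiff ℝ ∞ (coeffScaling l) := by
  unfold coeffScaling; fun_prop

lemma contDiff_scaling (β γ δ l : ℝ) : ContDiff ℝ ∞ (scaling β γ δ l) := by
  unfold scaling; fun_prop

/-- The scaling of the variables as a homeomorphism. -/
noncomputable def varHomeomorph {β l : ℝ} (hβ : β ≠ 0) (hl : l ≠ 0) (γ δ : ℝ) : Vars ≃ₜ Vars where
  toFun := varScaling β γ δ l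
  invFun := varScaling β⁻¹ (-(β⁻¹ * γ)) (-(β⁻¹ ^ 5 * δ)) l⁻¹
  left_inv := varScaling_left_inv hβ hl γ δ
  right_inv := varScaling_right_inv hβ hl γ δ
  continuous_toFun := (contDiff_varScaling _ _ _ _).continuous
  continuous_invFun := (contDiff_varScaling _ _ _ _).continuous

/-- The scaling of the coefficients as a homeomorphism. -/
noncomputable def coeffHomeomorph {l : ℝ} (hl : l ≠ 0) : Coeffs ≃ₜ Coeffs where
  toFun := coeffScaling l
  invFun := coeffScaling l⁻¹
  left_inv θ := by rw [coeffScaling_comp, inv_mul_cancel₀ hl, coeffScaling_one]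
  right_inv θ := by rw [coeffScaling_comp, mul_inv_cancel₀ hl, coeffScaling_one]
  continuous_toFun := (contDiff_coeffScaling _).continuous
  continuous_invFun := (contDiff_coeffScaling _).continuous

lemma isOpen_arbitraryElements : IsOpen arbitraryElements := by
  have h1 : IsOpen {θ : Coeffs | θ.1 ≠ 0} := isOpen_ne_fun (by fun_prop) (by fun_prop)
  have h2 : IsOpen {θ : Coeffs | θ.2.1 ≠ 0} := isOpen_ne_fun (by fun_prop) (by fun_prop)
  have h3 : IsOpen {θ : Coeffs | θ.2.2 ≠ 0} := isOpen_ne_fun (by fun_prop) (by fun_prop)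
  exact h1.inter (h2.inter h3)

lemma one_mem_arbitraryElements : ((1, 1, 1) : Coeffs) ∈ arbitraryElements := by
  simp [arbitraryElements]

lemma image_coeffScaling {l : ℝ} (hl : l ≠ 0) :
    coeffScaling l '' arbitraryElements = arbitraryElements := by
  ext θ
  constructor
  · rintro ⟨θ, h, rfl⟩
    exact coeffScaling_mem hl h
  · intro h
    refine ⟨coeffScaling l⁻¹ θ, coeffScaling_mem (inv_ne_zero hl) h, ?_⟩
    rw [coeffScaling_comp, mul_inv_cancel₀ hl, coeffScaling_one]

lemma image_scaling_prod {β l : ℝ} (hl : l ≠ 0) (γ δ : ℝ) (Ω : Set Vars) :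
    scaling β γ δ l '' (Ω ×ˢ arbitraryElements) =
      (varScaling β γ δ l '' Ω) ×ˢ arbitraryElements := by
  have : scaling β γ δ l = Prod.map (varScaling β γ δ l) (coeffScaling l) := rfl
  rw [this, Set.prodMap_image_prod, image_coeffScaling hl]

/-- A transformation that scales the variables maps equations of the class to each other. -/
lemma mapsEquation_of_eqOn {φ : OpenPartialHomeomorph Vars Vars} {β γ δ l : ℝ} (hβ : β ≠ 0)
    (hl : l ≠ 0) (h : Set.EqOn φ (varScaling β γ δ l) φ.source) (θ : Coeffs) :
    MapsEquation φ θ (coeffScaling l θ) := by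
  rintro u p v q ⟨hu, hv, hs, hp, hg⟩
  have hcu : ContinuousAt (fun r => (r, u r)) p :=
    continuousAt_id.prodMk hu.continuousAt
  have hmem : ∀ᶠ r in 𝓝 p, (r, u r) ∈ φ.source :=
    hcu.eventually (φ.open_source.mem_nhds hs)
  have hβl : β ^ 2 * l ≠ 0 := mul_ne_zero (pow_ne_zero _ hβ) hl
  have key : ∀ᶠ r in 𝓝 p, u r = β ^ 2 * l * v (β ^ 5 * r.1 + δ, β * r.2 + γ) := by
    filter_upwards [hg, hmem] with r h1 h2
    rw [h h2] at h1
    simp only [varScaling] at h1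
    rw [h1]
    field_simp
  have hq : q = (β ^ 5 * p.1 + δ, β * p.2 + γ) := by
    rw [h hs] at hp
    exact (congrArg Prod.fst hp).symm
  have hup : u p = β ^ 2 * l * v q := by rw [key.self_of_nhds, hq]
  have hdt : dt u p = β ^ 2 * l * (β ^ 5 * dt v q) := by
    have e : (fun s => u (s, p.2)) =ᶠ[𝓝 p.1]
        fun s => β ^ 2 * l * v (β ^ 5 * s + δ, β * p.2 + γ) := by
      have hc : Filter.Tendsto (fun s : ℝ => (s, p.2)) (𝓝 p.1) (𝓝 p) :=
        (by fun_prop : Continuous fun s : ℝ => (s, p.2)).tendsto' _ _ rfl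
      exact hc.eventually key
    rw [dt, e.deriv_eq, deriv_const_mul_field,
      deriv_comp_affine (fun s => v (s, β * p.2 + γ)), dt, hq]
  have hdx : ∀ k, dx k u p = β ^ 2 * l * (β ^ k * dx k v q) := by
    intro k
    have e : (fun y => u (p.1, y)) =ᶠ[𝓝 p.2]
        fun y => β ^ 2 * l * v (β ^ 5 * p.1 + δ, β * y + γ) := by
      have hc : Filter.Tendsto (fun y : ℝ => (p.1, y)) (𝓝 p.2) (𝓝 p) :=
        (by fun_prop : Continuous fun y : ℝ => (p.1, y)).tendsto' _ _ rfl
      exact hc.eventually key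
    rw [dx, e.iteratedDeriv_eq, iteratedDeriv_const_mul_field,
      iteratedDeriv_comp_affine (fun y => v (β ^ 5 * p.1 + δ, y)), dx, hq]
  unfold SatisfiesAt
  rw [hup, hdt, hdx, hdx, hdx, hdx]
  -- With `u = β² l v`, every term of the equation picks up the common factor `β ^ 7 * l` once the
  -- coefficients are rescaled.
  have hf : β ^ 7 * l ≠ 0 := mul_ne_zero (pow_ne_zero _ hβ) hl
  refine Iff.trans ?_ (mul_eq_zero_iff_left hf)
  simp only [coeffScaling]
  constructor <;> intro h <;> linear_combination h

/-- Two scalings of the variables that agree on a nonempty open set are equal. -/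
lemma varScaling_inj {Ω : Set Vars} (ho : IsOpen Ω) (hne : Ω.Nonempty)
    {β γ δ l β' γ' δ' l' : ℝ} (hβ : β ≠ 0) (hl : l ≠ 0) (hl' : l' ≠ 0)
    (h : Set.EqOn (varScaling β γ δ l) (varScaling β' γ' δ' l') Ω) :
    β' = β ∧ γ' = γ ∧ δ' = δ ∧ l' = l := by
  obtain ⟨z, hz⟩ := hne
  -- One nearby point, shifted in `x` and `u` together, suffices: its `x`-component determines `β`
  -- and its `u`-component then determines `l`.
  have hc : Filter.Tendsto (fun e : ℝ => ((z.1.1, z.1.2 + e), z.2 + e)) (𝓝[≠] 0) (𝓝 z) :=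
    ((by fun_prop : Continuous fun e : ℝ => ((z.1.1, z.1.2 + e), z.2 + e)).tendsto' 0 z
      (by simp)).mono_left nhdsWithin_le_nhds
  obtain ⟨e, he, he0⟩ := ((hc.eventually (ho.mem_nhds hz)).and self_mem_nhdsWithin).exists
  have he0 : e ≠ 0 := he0
  have h1 := h hz
  have h2 := h he
  simp only [varScaling, Prod.mk.injEq] at h1 h2
  obtain ⟨⟨a1, a2⟩, a3⟩ := h1
  obtain ⟨⟨b1, b2⟩, b3⟩ := h2
  have hββ : β' = β := by
    have : e * β' = e * β := by linear_combination b2.symm - a2.symm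
    exact mul_left_cancel₀ he0 this
  subst hββ
  refine ⟨rfl, by linarith, by linarith, ?_⟩
  field_simp at a3 b3
  have : e * l' = e * l := by linear_combination b3 - a3
  exact mul_left_cancel₀ he0 this

/-! ### Asymptotic expansions and iterated derivatives -/

/-- The coefficients vanish from the lowest upwards: once those below `k` are zero, the terms above
`k` are `o(y ^ k)`, so `b k * y ^ k` is as well. -/
lemma eq_zero_of_sum_isLittleO {n : ℕ} {b : ℕ → ℝ}
    (h : (fun y : ℝ => ∑ j ∈ Finset.range (n + 1), b j * y ^ j) =o[𝓝 0] fun y => y ^ n) :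
    ∀ k ≤ n, b k = 0 := by
  intro k
  induction k using Nat.strong_induction_on with
  | _ k ih =>
    intro hk
    have h1 : (fun y : ℝ => ∑ j ∈ Finset.range (n + 1), b j * y ^ j) =o[𝓝 0] fun y => y ^ k := by
      refine h.trans_isBigO ?_
      rcases hk.eq_or_lt with rfl | hk
      · exact isBigO_refl _ _
      · exact (isLittleO_pow_pow hk).isBigO
    have h2 : (fun y : ℝ => ∑ j ∈ (Finset.range (n + 1)).erase k, b j * y ^ j)
        =o[𝓝 0] fun y => y ^ k := by
      refine IsLittleO.fun_sum fun j hj => ?_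
      rcases lt_or_gt_of_ne (Finset.ne_of_mem_erase hj) with hlt | hgt
      · have : b j = 0 := ih j hlt (by omega)
        simp [this]
      · exact (isLittleO_pow_pow hgt).const_mul_left _
    have h3 : (fun y : ℝ => b k * y ^ k) =o[𝓝 0] fun y => y ^ k := by
      refine (h1.sub h2).congr_left fun y => ?_
      rw [← Finset.add_sum_erase _ _ (Finset.mem_range.2 (Nat.lt_succ_of_le hk))]
      ring
    by_contra hb
    have h4 := (isLittleO_const_mul_left_iff hb).1 h3
    have hne : ∃ᶠ y : ℝ in 𝓝 0, y ^ k ≠ 0 := by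
      have : ∀ᶠ y : ℝ in 𝓝[≠] 0, y ^ k ≠ 0 := by
        filter_upwards [self_mem_nhdsWithin] with y hy using pow_ne_zero _ hy
      exact this.frequently.filter_mono nhdsWithin_le_nhds
    exact isLittleO_irrefl hne h4

/-- The coefficients of an asymptotic expansion of a smooth function are its Taylor
coefficients. -/
lemma iteratedDeriv_eq_of_isLittleO {f : ℝ → ℝ} {x : ℝ} {n : ℕ} (hf : ContDiffAt ℝ n f x)
    {a : ℕ → ℝ}
    (h : (fun y => f (x + y) - ∑ j ∈ Finset.range (n + 1), a j * y ^ j) =o[𝓝 0] fun y => y ^ n) :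
    ∀ k ≤ n, iteratedDeriv k f x = k.factorial * a k := by
  obtain ⟨r, hr, hball⟩ := Metric.eventually_nhds_iff_ball.1 (hf.eventually (by simp))
  have hT := taylor_isLittleO (convex_ball x r) (Metric.mem_ball_self hr)
    (fun y hy => (hball y hy).contDiffWithinAt)
  rw [Metric.isOpen_ball.nhdsWithin_eq (Metric.mem_ball_self hr)] at hT
  have hc : Tendsto (fun y : ℝ => x + y) (𝓝 0) (𝓝 x) :=
    (by fun_prop : Continuous fun y : ℝ => x + y).tendsto' _ _ (by simp)
  have hT' := hT.comp_tendsto hc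
  have h5 : (fun y : ℝ => ∑ j ∈ Finset.range (n + 1),
      (a j - ((j.factorial : ℝ)⁻¹ * iteratedDeriv j f x)) * y ^ j) =o[𝓝 0] fun y => y ^ n := by
    refine (hT'.sub (h.congr_right fun y => ?_)).congr (fun y => ?_) (fun y => ?_)
    · simp
    · simp only [Function.comp_apply, taylor_within_apply, add_sub_cancel_left, smul_eq_mul]
      have : ∀ j, iteratedDerivWithin j f (Metric.ball x r) x = iteratedDeriv j f x := fun j =>
        iteratedDerivWithin_of_isOpen Metric.isOpen_ball (Metric.mem_ball_self hr)
      simp only [this, sub_mul, Finset.sum_sub_distrib]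
      rw [sub_sub_sub_cancel_left]
      congr 1
      exact Finset.sum_congr rfl fun j _ => by ring
    · simp
  intro k hk
  have := eq_zero_of_sum_isLittleO h5 k hk
  have hk0 : (k.factorial : ℝ) ≠ 0 := by exact_mod_cast k.factorial_ne_zero
  field_simp at this
  linarith

/-! ### Restrictions of functions to the coordinate lines -/

lemma contDiffAt_line_x {v : Base → ℝ} {q : Base} (hv : ContDiffAt ℝ ∞ v q) :
    ContDiffAt ℝ ∞ (fun y => v (q.1, y)) q.2 :=
  ContDiffAt.comp q.2 (f := fun y : ℝ => (q.1, y)) (g := v) hv (by fun_prop)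

lemma hasDerivAt_line_t {v : Base → ℝ} {q : Base} (hv : ContDiffAt ℝ ∞ v q) :
    HasDerivAt (fun s => v (s, q.2)) (dt v q) q.1 := by
  have : ContDiffAt ℝ ∞ (fun s => v (s, q.2)) q.1 :=
    ContDiffAt.comp q.1 (f := fun s : ℝ => (s, q.2)) (g := v) hv (by fun_prop)
  exact (this.differentiableAt (by simp)).hasDerivAt

lemma dx_one_eq (v : Base → ℝ) (q : Base) : dx 1 v q = deriv (fun y => v (q.1, y)) q.2 := by
  simp [dx]

lemma dx_zero_eq (v : Base → ℝ) (q : Base) : dx 0 v q = v q := by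
  simp [dx]

lemma fderiv_eq_dt_dx {v : Base → ℝ} {q : Base} (hv : ContDiffAt ℝ ∞ v q) (s y : ℝ) :
    fderiv ℝ v q (s, y) = s * dt v q + y * dx 1 v q := by
  have hd := (hv.differentiableAt (by simp)).hasFDerivAt
  have h1 : HasDerivAt (fun s => v (s, q.2)) (fderiv ℝ v q (1, 0)) q.1 :=
    HasFDerivAt.comp_hasDerivAt (f := fun s : ℝ => (s, q.2)) q.1 hd
      ((hasDerivAt_id _).prodMk (hasDerivAt_const _ _))
  have h2 : HasDerivAt (fun y => v (q.1, y)) (fderiv ℝ v q (0, 1)) q.2 :=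
    HasFDerivAt.comp_hasDerivAt (f := fun y : ℝ => (q.1, y)) q.2 hd
      ((hasDerivAt_const _ _).prodMk (hasDerivAt_id _))
  rw [dx_one_eq, dt, h1.deriv, h2.deriv]
  have : ((s, y) : Base) = s • (1, 0) + y • (0, 1) := by simp
  rw [this, map_add, map_smul, map_smul, smul_eq_mul, smul_eq_mul]

lemma dx_eq_of_isLittleO {v : Base → ℝ} {q : Base} (hv : ContDiffAt ℝ ∞ v q) {a : Fin 6 → ℝ}
    (h : (fun y => v (q.1, q.2 + y) - ∑ j, a j * y ^ (j : ℕ)) =o[𝓝 0] fun y : ℝ => y ^ 5)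
    (k : Fin 6) : dx k v q = (k : ℕ).factorial * a k := by
  have hf : ContDiffAt ℝ (5 : ℕ) (fun y => v (q.1, y)) q.2 :=
    contDiffAt_infty.1 (contDiffAt_line_x hv) 5
  -- The sum stops at index 5, so the value 0 beyond it is only a filler.
  have := iteratedDeriv_eq_of_isLittleO hf (a := fun j => if hj : j < 6 then a ⟨j, hj⟩ else 0)
    (by
      refine h.congr_left fun y => ?_
      rw [Finset.sum_range]
      congr 1) k (by omega)
  simpa [dx] using this

/-! ### Polynomial test functions -/

/-- A polynomial with prescribed `x`-derivatives `c` at `p`, and with prescribed first and fifth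
coefficients in `t`. -/
noncomputable def testFun (p : Base) (n e : ℝ) (c : Fin 6 → ℝ) (r : Base) : ℝ :=
  n * (r.1 - p.1) + e * (r.1 - p.1) ^ 5 +
    (c 0 + c 1 * (r.2 - p.2) + c 2 / 2 * (r.2 - p.2) ^ 2 + c 3 / 6 * (r.2 - p.2) ^ 3 +
      c 4 / 24 * (r.2 - p.2) ^ 4 + c 5 / 120 * (r.2 - p.2) ^ 5)

lemma contDiff_testFun (p : Base) (n e : ℝ) (c : Fin 6 → ℝ) : ContDiff ℝ ∞ (testFun p n e c) := by
  unfold testFun; fun_prop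

lemma testFun_self (p : Base) (n e : ℝ) (c : Fin 6 → ℝ) : testFun p n e c p = c 0 := by
  simp [testFun]

lemma dx_testFun (p : Base) (n e : ℝ) (c : Fin 6 → ℝ) (k : Fin 6) :
    dx k (testFun p n e c) p = c k := by
  have := dx_eq_of_isLittleO (contDiff_testFun p n e c).contDiffAt
    (a := ![c 0, c 1, c 2 / 2, c 3 / 6, c 4 / 24, c 5 / 120]) (q := p) (by
      refine (isLittleO_zero _ _).congr_left fun y => ?_
      simp [testFun, Fin.sum_univ_six]) k
  rw [this]
  fin_cases k <;> simp [Nat.factorial] <;> field_simp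

lemma dt_testFun (p : Base) (n e : ℝ) (c : Fin 6 → ℝ) : dt (testFun p n e c) p = n := by
  have h0 : HasDerivAt (fun s : ℝ => s - p.1) 1 p.1 := (hasDerivAt_id _).sub_const _
  have h : HasDerivAt (fun s => testFun p n e c (s, p.2)) n p.1 := by
    have := ((h0.const_mul n).add ((h0.pow 5).const_mul e)).add_const (c 0)
    simpa [testFun] using this
  exact h.deriv

lemma satisfiesAt_testFun (θ : Coeffs) (p : Base) (n e : ℝ) (c : Fin 6 → ℝ) :
    SatisfiesAt θ (testFun p n e c) p ↔
      n + θ.1 * c 0 * c 3 + θ.2.1 * c 1 * c 2 + θ.2.2 * c 0 ^ 2 * c 1 + c 5 = 0 := by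
  have h := dx_testFun p n e c
  unfold SatisfiesAt
  rw [testFun_self, dt_testFun, show dx 1 (testFun p n e c) p = c 1 from h 1,
    show dx 2 (testFun p n e c) p = c 2 from h 2, show dx 3 (testFun p n e c) p = c 3 from h 3,
    show dx 5 (testFun p n e c) p = c 5 from h 5]

lemma hasFDerivAt_of_contDiffAt {u : Base → ℝ} {p : Base} (hu : ContDiffAt ℝ ∞ u p) :
    HasFDerivAt u (fderiv ℝ u p) p := (hu.differentiableAt (by simp)).hasFDerivAt

lemma fderiv_testFun (p : Base) (n e : ℝ) (c : Fin 6 → ℝ) (r : Base) :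
    fderiv ℝ (testFun p n e c) p r = n * r.1 + c 1 * r.2 := by
  obtain ⟨s, y⟩ := r
  rw [fderiv_eq_dt_dx (contDiff_testFun p n e c).contDiffAt, dt_testFun,
    show dx 1 (testFun p n e c) p = c 1 from dx_testFun p n e c 1]
  ring

/-! ### Germs of transformed functions -/

namespace IsLocalDiffeo

variable {φ : OpenPartialHomeomorph Vars Vars}

lemma contDiffAt (hφ : IsLocalDiffeo φ) {z : Vars} (hz : z ∈ φ.source) : ContDiffAt ℝ ∞ φ z :=
  hφ.contDiffOn.contDiffAt (φ.open_source.mem_nhds hz)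

lemma hasStrictFDerivAt (hφ : IsLocalDiffeo φ) {z : Vars} (hz : z ∈ φ.source) :
    HasStrictFDerivAt φ (fderiv ℝ φ z) z :=
  (hφ.contDiffAt hz).hasStrictFDerivAt (by simp)

lemma hasFDerivAt (hφ : IsLocalDiffeo φ) {z : Vars} (hz : z ∈ φ.source) :
    HasFDerivAt φ (fderiv ℝ φ z) z :=
  (hφ.hasStrictFDerivAt hz).hasFDerivAt

/-- Differentiating `φ ∘ φ.symm = id` gives a right inverse. Degenerate derivatives are later
excluded by a vector that would have no preimage. -/
lemma fderiv_surjective (hφ : IsLocalDiffeo φ) {z : Vars} (hz : z ∈ φ.source) :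
    Function.Surjective (fderiv ℝ φ z) := by
  have hψ : DifferentiableAt ℝ φ.symm (φ z) :=
    (hφ.contDiffOn_symm.contDiffAt (φ.open_target.mem_nhds (φ.map_source hz))).differentiableAt
      (by simp)
  have hφ' : HasFDerivAt φ (fderiv ℝ φ z) (φ.symm (φ z)) := by
    rw [φ.left_inv hz]; exact hφ.hasFDerivAt hz
  have hc := hφ'.comp (φ z) hψ.hasFDerivAt
  have hid : HasFDerivAt (φ ∘ φ.symm) (ContinuousLinearMap.id ℝ Vars) (φ z) := by
    refine (hasFDerivAt_id (φ z)).congr_of_eventuallyEq ?_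
    filter_upwards [φ.open_target.mem_nhds (φ.map_source hz)] with w hw using φ.right_inv hw
  intro w
  exact ⟨fderiv ℝ φ.symm (φ z) w, congrArg (fun L => L w) (hc.unique hid)⟩

end IsLocalDiffeo

/-- A smooth function whose graph is mapped transversally has a transformed germ. -/
lemma exists_transformsGerm {φ : OpenPartialHomeomorph Vars Vars} (hφ : IsLocalDiffeo φ)
    {u : Base → ℝ} {p : Base} (hu : ContDiffAt ℝ ∞ u p) (hs : (p, u p) ∈ φ.source)
    (hinj : ∀ r, (fderiv ℝ φ (p, u p) (r, fderiv ℝ u p r)).1 = 0 → r = 0) :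
    ∃ v g, TransformsGerm φ u p v (φ (p, u p)).1 ∧ g (φ (p, u p)).1 = p ∧
      (∃ G' : Base ≃L[ℝ] Base, (∀ r, G' r = (fderiv ℝ φ (p, u p) (r, fderiv ℝ u p r)).1) ∧
        HasFDerivAt g (G'.symm : Base →L[ℝ] Base) (φ (p, u p)).1) ∧
      ∀ᶠ R in 𝓝 (φ (p, u p)).1, (φ (g R, u (g R))).1 = R := by
  set z : Vars := (p, u p) with hz
  set G : Base → Base := fun r => (φ (r, u r)).1 with hG
  have hgr : ContDiffAt ℝ ∞ (fun r => (r, u r)) p := contDiffAt_id.prodMk hu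
  have hφu : ContDiffAt ℝ ∞ (fun r => φ (r, u r)) p :=
    ContDiffAt.comp p (f := fun r => (r, u r)) (g := φ) (hφ.contDiffAt hs) hgr
  have hGs : ContDiffAt ℝ ∞ G p := hφu.fst
  set L : Base →L[ℝ] Base := (ContinuousLinearMap.fst ℝ Base ℝ).comp
    ((fderiv ℝ φ z).comp ((ContinuousLinearMap.id ℝ Base).prod (fderiv ℝ u p))) with hL
  have hGL : HasFDerivAt G L p :=
    (HasFDerivAt.comp (f := fun r => (r, u r)) (g := φ) p (hφ.hasFDerivAt hs)
      ((hasFDerivAt_id p).prodMk (hasFDerivAt_of_contDiffAt hu))).fst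
  have hLinj : Function.Injective (L : Base →ₗ[ℝ] Base) :=
    (injective_iff_map_eq_zero _).2 fun r hr => hinj r hr
  set G' : Base ≃L[ℝ] Base :=
    (LinearEquiv.ofInjectiveEndo (L : Base →ₗ[ℝ] Base) hLinj).toContinuousLinearEquiv with hG'
  have hG'L : (G' : Base →L[ℝ] Base) = L := by
    ext <;> rfl
  have hGG' : HasFDerivAt G (G' : Base →L[ℝ] Base) p := hG'L ▸ hGL
  have hst := hGs.hasStrictFDerivAt' hGG' (by simp)
  -- `g` recovers the old base point from the new one, so the new function is the `u`-component of
  -- `φ` on the graph of `u` over `g R`.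
  set g := hst.localInverse G G' p with hg
  have hgp : g (G p) = p := hst.localInverse_apply_image
  have hgs : ContDiffAt ℝ ∞ g (G p) := hGs.to_localInverse hGG' (by simp)
  have hφg : ContDiffAt ℝ ∞ (fun R => φ (g R, u (g R))) (G p) :=
    ContDiffAt.comp (G p) (f := g) (g := fun r => φ (r, u r)) (by rw [hgp]; exact hφu) hgs
  refine ⟨fun R => (φ (g R, u (g R))).2, g, ⟨hu, hφg.snd, hs, ?_, ?_⟩, hgp, ⟨G', fun r => rfl,
    hst.to_localInverse.hasFDerivAt⟩, hst.eventually_right_inverse⟩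
  · change φ z = (G p, (φ (g (G p), u (g (G p)))).2)
    rw [hgp]
  · filter_upwards [hst.eventually_left_inverse] with r hr
    change (φ (g (G r), u (g (G r)))).2 = _
    rw [show g (G r) = r from hr]

/-- The chain rule for a transformed germ. -/
lemma TransformsGerm.fderiv_eq {φ : OpenPartialHomeomorph Vars Vars} (hφ : IsLocalDiffeo φ)
    {u v : Base → ℝ} {p q : Base} (h : TransformsGerm φ u p v q) (r : Base) :
    fderiv ℝ v q (fderiv ℝ φ (p, u p) (r, fderiv ℝ u p r)).1 =
      (fderiv ℝ φ (p, u p) (r, fderiv ℝ u p r)).2 := by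
  have hφu := HasFDerivAt.comp (f := fun r => (r, u r)) (g := φ) p (hφ.hasFDerivAt h.mem_source)
    ((hasFDerivAt_id p).prodMk (hasFDerivAt_of_contDiffAt h.smooth_left))
  have hq : (φ (p, u p)).1 = q := by rw [h.map_point]
  have hv : HasFDerivAt v (fderiv ℝ v q) (φ (p, u p)).1 := by
    rw [hq]
    exact hasFDerivAt_of_contDiffAt h.smooth_right
  have h1 := HasFDerivAt.comp (f := fun r => (φ (r, u r)).1) (g := v) p hv hφu.fst
  have h2 := hφu.snd.congr_of_eventuallyEq h.map_graph
  exact congrArg (fun L => L r) (h1.unique h2)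

/-- Comparison of the transformed germs of two functions, to the leading order of the difference
of these functions. -/
lemma TransformsGerm.sub_isLittleO {φ : OpenPartialHomeomorph Vars Vars} (hφ : IsLocalDiffeo φ)
    {u v u₁ v₁ : Base → ℝ} {p q : Base} (h : TransformsGerm φ u p v q)
    (h₁ : TransformsGerm φ u₁ p v₁ q) (hu : u₁ p = u p) {g : Base → Base} (hg : Tendsto g (𝓝 q) (𝓝 p))
    (hG : ∀ᶠ R in 𝓝 q, (φ (g R, u (g R))).1 = R) :
    ∃ κ ≠ 0, (fun R => v₁ R - v R - κ * (u₁ (g R) - u (g R))) =o[𝓝 q]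
      fun R => u₁ (g R) - u (g R) := by
  set z : Vars := (p, u p) with hz
  have hq : (φ z).1 = q := by rw [hz, h.map_point]
  -- `H` is a defining function of the graph of `u₁`: it vanishes there, and on the graph of `u` it
  -- equals `v₁ - v`.
  set H : Vars → ℝ := fun w => v₁ (φ w).1 - (φ w).2 with hH
  set H' : Vars →L[ℝ] ℝ := (fderiv ℝ v₁ q).comp ((ContinuousLinearMap.fst ℝ Base ℝ).comp
    (fderiv ℝ φ z)) - (ContinuousLinearMap.snd ℝ Base ℝ).comp (fderiv ℝ φ z) with hH'
  have hv₁ : HasStrictFDerivAt v₁ (fderiv ℝ v₁ q) (φ z).1 :=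
    hq ▸ h₁.smooth_right.hasStrictFDerivAt (by simp)
  have hst : HasStrictFDerivAt H H' z :=
    (HasStrictFDerivAt.comp (f := fun w => (φ w).1) (g := v₁) z hv₁
      (hφ.hasStrictFDerivAt h.mem_source).fst).sub (hφ.hasStrictFDerivAt h.mem_source).snd
  -- Otherwise `H'` would vanish on the tangent plane of the graph of `u₁` and on the vertical
  -- direction, hence identically; but it equals `-1` on a preimage of the vertical vector.
  have hH'u : H' (0, 1) ≠ 0 := by
    intro h0
    have htan : ∀ r, H' (r, fderiv ℝ u₁ p r) = 0 := by
      intro r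
      have := h₁.fderiv_eq hφ r
      rw [hu] at this
      exact sub_eq_zero.2 this
    have hzero : ∀ e, H' e = 0 := by
      rintro ⟨r, c⟩
      have : ((r, c) : Vars) = (r, fderiv ℝ u₁ p r) + (c - fderiv ℝ u₁ p r) • ((0 : Base), (1 : ℝ)) := by
        simp
      rw [this, map_add, map_smul, h0, htan, smul_zero, add_zero]
    obtain ⟨e, he⟩ := hφ.fderiv_surjective h.mem_source (0, 1)
    have h1 := hzero e
    change fderiv ℝ v₁ q (fderiv ℝ φ z e).1 - (fderiv ℝ φ z e).2 = 0 at h1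
    rw [he, map_zero] at h1
    norm_num at h1
  refine ⟨-H' (0, 1), neg_ne_zero.2 hH'u, ?_⟩
  have hc : Tendsto (fun R => (((g R, u (g R)), (g R, u₁ (g R))) : Vars × Vars)) (𝓝 q)
      (𝓝 (z, z)) := by
    have h1 : Tendsto (fun R => u (g R)) (𝓝 q) (𝓝 (u p)) :=
      h.smooth_left.continuousAt.tendsto.comp hg
    have h2 : Tendsto (fun R => u₁ (g R)) (𝓝 q) (𝓝 (u p)) := by
      rw [← hu]; exact h₁.smooth_left.continuousAt.tendsto.comp hg
    exact (hg.prodMk_nhds h1).prodMk_nhds (hg.prodMk_nhds h2)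
  -- Strict differentiability is needed here because both points, on the two graphs over `g R`, move
  -- with `R`.
  have hO := hst.isLittleO.comp_tendsto hc
  have hO' : (fun R => H (g R, u (g R)) - H (g R, u₁ (g R)) -
      H' ((g R, u (g R)) - (g R, u₁ (g R)))) =o[𝓝 q] fun R => u₁ (g R) - u (g R) := by
    refine hO.trans_isBigO (IsBigO.of_bound 1 (Eventually.of_forall fun R => ?_))
    simp [Prod.norm_def, abs_sub_comm]
  refine hO'.congr' ?_ EventuallyEq.rfl
  filter_upwards [hG, hg.eventually h.map_graph, hg.eventually h₁.map_graph] with R h1 h2 h3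
  have e1 : H (g R, u (g R)) = v₁ R - v R := by
    simp only [hH]
    rw [← h2, h1]
  have e2 : H (g R, u₁ (g R)) = 0 := sub_eq_zero.2 h3
  have e3 : ((g R, u (g R)) - (g R, u₁ (g R)) : Vars) = (u (g R) - u₁ (g R)) • (0, 1) := by
    simp
  rw [e1, e2, e3, map_smul, smul_eq_mul]
  ring

/-- The difference of the equations for two functions with the same second-order jet in `x`. -/
lemma SatisfiesAt.sub_eq_zero {θ : Coeffs} {v v₁ : Base → ℝ} {q : Base}
    (hv : ContDiffAt ℝ ∞ v q) (hv₁ : ContDiffAt ℝ ∞ v₁ q) (h : SatisfiesAt θ v q)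
    (h₁ : SatisfiesAt θ v₁ q) {a₃ a₄ a₅ : ℝ}
    (ha : (fun y => v₁ (q.1, q.2 + y) - v (q.1, q.2 + y) - (a₃ * y ^ 3 + a₄ * y ^ 4 + a₅ * y ^ 5))
      =o[𝓝 0] fun y : ℝ => y ^ 5) :
    dt v₁ q - dt v q + 6 * θ.1 * v q * a₃ + 120 * a₅ = 0 ∧ dx 1 v₁ q = dx 1 v q := by
  -- Agreement up to second order cancels the `B` and `C` terms; `a₄` drops out because the equation
  -- has no `u_xxxx`. The factors 6 and 120 are `3!` and `5!`.
  have hd := dx_eq_of_isLittleO (hv₁.sub hv) (a := ![0, 0, 0, a₃, a₄, a₅]) (by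
    refine ha.congr_left fun y => ?_
    simp [Fin.sum_univ_six])
  have hs : ∀ k, k < 6 → dx k (fun x => v₁ x - v x) q = dx k v₁ q - dx k v q := fun k _ =>
    iteratedDeriv_fun_sub (contDiffAt_infty.1 (contDiffAt_line_x hv₁) k)
      (contDiffAt_infty.1 (contDiffAt_line_x hv) k)
  have h0 := hd 0
  have h1 := hd 1
  have h2 := hd 2
  have h3 := hd 3
  have h5 := hd 5
  simp [hs, Nat.factorial, dx_zero_eq] at h0 h1 h2 h3 h5
  unfold SatisfiesAt at h h₁
  rw [sub_eq_iff_eq_add] at h0 h1 h2 h3 h5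
  rw [h0, h1, h2, h3, h5] at h₁
  exact ⟨by linear_combination h₁ - h, by rw [h1, zero_add]⟩

/-! ### Perturbations that are detected by the leading order terms -/

/-- The difference of fifth powers factors into `f y - a y = o(y)` and a sum of products that is
`O(y ^ 4)`. -/
lemma pow_five_isLittleO {f : ℝ → ℝ} {a : ℝ} (hf : HasDerivAt f a 0) (h0 : f 0 = 0) :
    (fun y => f y ^ 5 - a ^ 5 * y ^ 5) =o[𝓝 0] fun y : ℝ => y ^ 5 := by
  have h1 : (fun y => f y - a * y) =o[𝓝 0] fun y : ℝ => y := by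
    have := hf.isLittleO
    simpa [h0, mul_comm] using this
  have h2 : (fun y : ℝ => a * y) =O[𝓝 0] fun y : ℝ => y := (isBigO_refl _ _).const_mul_left _
  have h3 : f =O[𝓝 0] fun y : ℝ => y := by
    simpa using h1.isBigO.add h2
  have h4 : (fun y => f y ^ 4 + f y ^ 3 * (a * y) + f y ^ 2 * (a * y) ^ 2 + f y * (a * y) ^ 3 +
      (a * y) ^ 4) =O[𝓝 0] fun y : ℝ => y ^ 4 := by
    refine ((((h3.pow 4).add ?_).add ?_).add ?_).add (h2.pow 4)
    · exact ((h3.pow 3).mul h2).congr_right fun y => by ring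
    · exact ((h3.pow 2).mul (h2.pow 2)).congr_right fun y => by ring
    · exact (h3.mul (h2.pow 3)).congr_right fun y => by ring
  exact (h1.mul_isBigO h4).congr (fun y => by ring) fun y => by ring

lemma tendsto_add_x (q : Base) : Tendsto (fun y : ℝ => ((q.1, q.2 + y) : Base)) (𝓝 0) (𝓝 q) :=
  (by fun_prop : Continuous fun y : ℝ => ((q.1, q.2 + y) : Base)).tendsto' _ _ (by simp)

lemma tendsto_add_t (q : Base) : Tendsto (fun s : ℝ => ((q.1 + s, q.2) : Base)) (𝓝 0) (𝓝 q) :=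
  (by fun_prop : Continuous fun s : ℝ => ((q.1 + s, q.2) : Base)).tendsto' _ _ (by simp)

lemma dt_sub_of_isLittleO {v v₁ : Base → ℝ} {q : Base} (hv : ContDiffAt ℝ ∞ v q)
    (hv₁ : ContDiffAt ℝ ∞ v₁ q) (h0 : v₁ q = v q) {a : ℝ}
    (h : (fun s => v₁ (q.1 + s, q.2) - v (q.1 + s, q.2) - a * s) =o[𝓝 0] fun s : ℝ => s) :
    dt v₁ q - dt v q = a := by
  have h1 : HasDerivAt (fun s => v₁ (q.1 + s, q.2) - v (q.1 + s, q.2)) (dt v₁ q - dt v q) 0 := by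
    have ht := (hasDerivAt_line_t hv₁).fun_sub (hasDerivAt_line_t hv)
    exact HasDerivAt.comp_const_add (f := fun s => v₁ (s, q.2) - v (s, q.2)) q.1 0
      (by simpa using ht)
  have h2 : HasDerivAt (fun s => v₁ (q.1 + s, q.2) - v (q.1 + s, q.2)) a 0 := by
    rw [hasDerivAt_iff_isLittleO]
    simpa [h0, mul_comm] using h
  exact h1.unique h2

/-- The transformed functions differ by `κ` times the pulled-back difference, so subtracting their
equations leaves `κ (a + 120 b) = 0`. In effect, the principal part `u_t + u_xxxxx` annihilates the
pulled-back difference. -/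
lemma TransformsGerm.add_eq_zero_of_perturbation {φ : OpenPartialHomeomorph Vars Vars}
    (hφ : IsLocalDiffeo φ) {θ : Coeffs}
    {u v u₁ v₁ : Base → ℝ} {p q : Base} (h : TransformsGerm φ u p v q)
    (h₁ : TransformsGerm φ u₁ p v₁ q) (hu : u₁ p = u p) {g : Base → Base} (hgq : g q = p)
    (hg : ContinuousAt g q) (hG : ∀ᶠ R in 𝓝 q, (φ (g R, u (g R))).1 = R)
    (hs : SatisfiesAt θ v q) (hs₁ : SatisfiesAt θ v₁ q) {a b : ℝ}
    (ha : HasDerivAt (fun s => u₁ (g (q.1 + s, q.2)) - u (g (q.1 + s, q.2))) a 0)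
    (hb : (fun y => u₁ (g (q.1, q.2 + y)) - u (g (q.1, q.2 + y)) - b * y ^ 5)
      =o[𝓝 0] fun y : ℝ => y ^ 5) :
    a + 120 * b = 0 := by
  have hg' : Tendsto g (𝓝 q) (𝓝 p) := by simpa [ContinuousAt, hgq] using hg
  obtain ⟨κ, hκ, ho⟩ := h.sub_isLittleO hφ h₁ hu hg' hG
  have hvq : v₁ q = v q := by
    have e1 := h.map_point
    have e2 := h₁.map_point
    rw [hu] at e2
    rw [e1] at e2
    exact (congrArg Prod.snd e2).symm
  have hdt : dt v₁ q - dt v q = κ * a := by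
    refine dt_sub_of_isLittleO h.smooth_right h₁.smooth_right hvq ?_
    have h1 := ho.comp_tendsto (tendsto_add_t q)
    have h2 : (fun s => u₁ (g (q.1 + s, q.2)) - u (g (q.1 + s, q.2)) - a * s)
        =o[𝓝 0] fun s : ℝ => s := by
      have := ha.isLittleO
      simpa [hgq, hu, mul_comm] using this
    have h3 : (fun s => u₁ (g (q.1 + s, q.2)) - u (g (q.1 + s, q.2))) =O[𝓝 0] fun s : ℝ => s := by
      simpa using h2.isBigO.add ((isBigO_refl (fun s : ℝ => s) (𝓝 0)).const_mul_left a)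
    refine ((h1.trans_isBigO h3).add (h2.const_mul_left κ)).congr_left fun s => ?_
    simp only [Function.comp_apply]
    ring
  have hx := (SatisfiesAt.sub_eq_zero (a₃ := 0) (a₄ := 0) (a₅ := κ * b) h.smooth_right
    h₁.smooth_right hs hs₁ (by
      have h1 := ho.comp_tendsto (tendsto_add_x q)
      have h3 : (fun y => u₁ (g (q.1, q.2 + y)) - u (g (q.1, q.2 + y)))
          =O[𝓝 0] fun y : ℝ => y ^ 5 := by
        simpa using hb.isBigO.add ((isBigO_refl (fun y : ℝ => y ^ 5) (𝓝 0)).const_mul_left b)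
      refine ((h1.trans_isBigO h3).add (hb.const_mul_left κ)).congr_left fun y => ?_
      simp only [Function.comp_apply]
      ring)).1
  rw [hdt] at hx
  exact mul_left_cancel₀ hκ (by linear_combination hx)

lemma map_vars_eq (D : Vars →L[ℝ] Vars) (s y c : ℝ) :
    D ((s, y), c) = s • D ((1, 0), 0) + y • D ((0, 1), 0) + c • D ((0, 0), 1) := by
  rw [← map_smul, ← map_smul, ← map_smul, ← map_add, ← map_add]
  simp

/-- The pair of germs obtained from two test functions with the same first-order jet. -/
lemma perturbed_testFun {φ : OpenPartialHomeomorph Vars Vars} (hφ : IsLocalDiffeo φ)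
    {θ θ' : Coeffs} (hM : MapsEquation φ θ θ') {z : Vars} (hz : z ∈ φ.source) {m n n₁ e c₅ : ℝ}
    (hinj : ∀ s y, (fderiv ℝ φ z ((s, y), n * s + m * y)).1 = 0 → s = 0 ∧ y = 0)
    (hinj₁ : ∀ s y, (fderiv ℝ φ z ((s, y), n₁ * s + m * y)).1 = 0 → s = 0 ∧ y = 0)
    (h : n + θ.2.2 * z.2 ^ 2 * m + c₅ = 0) :
    ∃ g : Base → Base, g (φ z).1 = z.1 ∧
      (∃ G' : Base ≃L[ℝ] Base, (∀ s y, G' (s, y) = (fderiv ℝ φ z ((s, y), n * s + m * y)).1) ∧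
        HasFDerivAt g (G'.symm : Base →L[ℝ] Base) (φ z).1) ∧
      (∃ f : Base → ℝ, ContinuousAt f z.1 ∧ f z.1 = z.2 ∧
        ∀ᶠ R in 𝓝 (φ z).1, (φ (g R, f (g R))).1 = R) ∧
      ∀ a b : ℝ,
        HasDerivAt (fun s => (n₁ - n) * ((g ((φ z).1.1 + s, (φ z).1.2)).1 - z.1.1) +
          e * ((g ((φ z).1.1 + s, (φ z).1.2)).1 - z.1.1) ^ 5 +
          (n - n₁) / 120 * ((g ((φ z).1.1 + s, (φ z).1.2)).2 - z.1.2) ^ 5) a 0 →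
        (fun y => (n₁ - n) * ((g ((φ z).1.1, (φ z).1.2 + y)).1 - z.1.1) +
          e * ((g ((φ z).1.1, (φ z).1.2 + y)).1 - z.1.1) ^ 5 +
          (n - n₁) / 120 * ((g ((φ z).1.1, (φ z).1.2 + y)).2 - z.1.2) ^ 5 - b * y ^ 5)
            =o[𝓝 0] (fun y : ℝ => y ^ 5) →
        a + 120 * b = 0 := by
  obtain ⟨p, u₀⟩ := z
  set u := testFun p n 0 ![u₀, m, 0, 0, 0, c₅] with hu
  -- The shift of the fifth derivative offsets the change of `u_t`, and `e` does not enter the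
  -- equation, so both functions satisfy it.
  set u₁ := testFun p n₁ e ![u₀, m, 0, 0, 0, c₅ + (n - n₁)] with hu₁
  have hup : u p = u₀ := testFun_self _ _ _ _
  have hu₁p : u₁ p = u₀ := testFun_self _ _ _ _
  have huc : ContDiffAt ℝ ∞ u p := (contDiff_testFun _ _ _ _).contDiffAt
  have hu₁c : ContDiffAt ℝ ∞ u₁ p := (contDiff_testFun _ _ _ _).contDiffAt
  have hud : ∀ s y, fderiv ℝ u p (s, y) = n * s + m * y := fun s y => fderiv_testFun _ _ _ _ _
  have hu₁d : ∀ s y, fderiv ℝ u₁ p (s, y) = n₁ * s + m * y := fun s y => fderiv_testFun _ _ _ _ _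
  obtain ⟨v, g, hv, hgp, ⟨G', hG', hg'⟩, hG⟩ := exists_transformsGerm hφ huc (by rwa [hup]) (by
    rintro ⟨s, y⟩ hr
    rw [hup, hud] at hr
    exact Prod.ext_iff.2 (hinj s y hr))
  obtain ⟨v₁, -, hv₁, -⟩ := exists_transformsGerm hφ hu₁c (by rwa [hu₁p]) (by
    rintro ⟨s, y⟩ hr
    rw [hu₁p, hu₁d] at hr
    exact Prod.ext_iff.2 (hinj₁ s y hr))
  rw [hu₁p] at hv₁
  rw [hup] at hv hgp hG' hg' hG
  have hs : SatisfiesAt θ' v _ := (hM _ _ _ _ hv).1 ((satisfiesAt_testFun _ _ _ _ _).2 (by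
    simp; linear_combination h))
  have hs₁ : SatisfiesAt θ' v₁ _ := (hM _ _ _ _ hv₁).1 ((satisfiesAt_testFun _ _ _ _ _).2 (by
    simp; linear_combination h))
  have hw : ∀ r, u₁ r - u r = (n₁ - n) * (r.1 - p.1) + e * (r.1 - p.1) ^ 5 +
      (n - n₁) / 120 * (r.2 - p.2) ^ 5 := by
    intro r
    simp [hu, hu₁, testFun]
    ring
  refine ⟨g, hgp, ⟨G', fun s y => by rw [hG', hud], hg'⟩, ⟨u, huc.continuousAt, hup, hG⟩,
    fun a b ha hb => ?_⟩
  refine hv.add_eq_zero_of_perturbation hφ hv₁ (hu₁p.trans hup.symm) hgp hg'.continuousAt hG hs hs₁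
    ?_ ?_
  · simp only [hw]
    exact ha
  · simp only [hw]
    exact hb

lemma hasDerivAt_add_x {g : Base → Base} {g' : Base →L[ℝ] Base} {q : Base}
    (hg : HasFDerivAt g g' q) : HasDerivAt (fun y => g (q.1, q.2 + y)) (g' (0, 1)) 0 := by
  have hl : HasDerivAt (fun y : ℝ => ((q.1, q.2 + y) : Base)) (0, 1) 0 :=
    (hasDerivAt_const _ _).prodMk ((hasDerivAt_id _).const_add _)
  have hg0 : HasFDerivAt g g' ((q.1, q.2 + (0 : ℝ)) : Base) := by simpa using hg
  exact HasFDerivAt.comp_hasDerivAt (f := fun y : ℝ => ((q.1, q.2 + y) : Base)) 0 hg0 hl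

lemma hasDerivAt_add_t {g : Base → Base} {g' : Base →L[ℝ] Base} {q : Base}
    (hg : HasFDerivAt g g' q) : HasDerivAt (fun s => g (q.1 + s, q.2)) (g' (1, 0)) 0 := by
  have hl : HasDerivAt (fun s : ℝ => ((q.1 + s, q.2) : Base)) (1, 0) 0 :=
    ((hasDerivAt_id _).const_add _).prodMk (hasDerivAt_const _ _)
  have hg0 : HasFDerivAt g g' ((q.1 + (0 : ℝ), q.2) : Base) := by simpa using hg
  exact HasFDerivAt.comp_hasDerivAt (f := fun s : ℝ => ((q.1 + s, q.2) : Base)) 0 hg0 hl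

lemma hasDerivAt_fst {f : ℝ → Base} {f' : Base} {x : ℝ} (h : HasDerivAt f f' x) :
    HasDerivAt (fun y => (f y).1) f'.1 x :=
  (ContinuousLinearMap.fst ℝ ℝ ℝ).hasFDerivAt.comp_hasDerivAt x h

lemma hasDerivAt_snd {f : ℝ → Base} {f' : Base} {x : ℝ} (h : HasDerivAt f f' x) :
    HasDerivAt (fun y => (f y).2) f'.2 x :=
  (ContinuousLinearMap.snd ℝ ℝ ℝ).hasFDerivAt.comp_hasDerivAt x h

/-! ### The new time variable -/

/-- The perturbation `(t - t₀) ^ 5` does not affect the source equation. Pulled back along the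
`X`-axis it is `(a y) ^ 5` to leading order with `a = ∂t/∂X`, so the target equation gives `120 a ^
5 = 0`. Thus the new `X`-direction has no old time component. -/
lemma fderiv_t_along {φ : OpenPartialHomeomorph Vars Vars} (hφ : IsLocalDiffeo φ)
    {θ θ' : Coeffs} (hM : MapsEquation φ θ θ') {z : Vars} (hz : z ∈ φ.source) {m n : ℝ}
    (hinj : ∀ s y, (fderiv ℝ φ z ((s, y), n * s + m * y)).1 = 0 → s = 0 ∧ y = 0) :
    (fderiv ℝ φ z ((0, 1), m)).1.1 = 0 := by
  obtain ⟨g, hgq, ⟨G', hG', hg'⟩, -, hM⟩ := perturbed_testFun hφ hM hz (e := 1) hinj hinj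
    (c₅ := -(n + θ.2.2 * z.2 ^ 2 * m)) (by ring)
  set q := (φ z).1 with hq
  set a := ((G'.symm : Base →L[ℝ] Base) (0, 1)).1 with ha
  have ht := (hasDerivAt_fst (hasDerivAt_add_t hg')).sub_const z.1.1
  have hx := (hasDerivAt_fst (hasDerivAt_add_x hg')).sub_const z.1.1
  have hpow := ht.fun_pow 5
  have h5 := pow_five_isLittleO hx (by simp [hgq])
  have key := hM 0 (a ^ 5) (by simpa [hgq] using hpow) (by simpa [ha] using h5)
  have ha0 : a = 0 := by
    have : a ^ 5 = 0 := by linarith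
    exact pow_eq_zero_iff (by norm_num) |>.1 this
  obtain ⟨b, hb⟩ : ∃ b, G'.symm (0, 1) = (0, b) := ⟨(G'.symm (0, 1)).2, Prod.ext ha0 rfl⟩
  have h1 : G' (0, b) = (0, 1) := by rw [← hb, G'.apply_symm_apply]
  have h2 : ((0, b), n * 0 + m * b) = b • (((0, 1), m) : Vars) := by simp [mul_comm]
  rw [hG', h2, map_smul] at h1
  have h3 := congrArg Prod.fst h1
  have h4 := congrArg Prod.snd h1
  simp only [Prod.smul_fst, Prod.smul_snd, smul_eq_mul] at h3 h4
  have hb0 : b ≠ 0 := by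
    rintro rfl
    simp at h4
  exact (mul_eq_zero.1 h3).resolve_left hb0

/-- A tangent plane with nonzero projected determinant is mapped transversally. -/
lemma eq_zero_of_det_ne_zero {D : Vars →L[ℝ] Vars} {m n : ℝ}
    (h : (D ((1, 0), n)).1.1 * (D ((0, 1), m)).1.2 - (D ((0, 1), m)).1.1 * (D ((1, 0), n)).1.2 ≠ 0)
    (s y : ℝ) (h0 : (D ((s, y), n * s + m * y)).1 = 0) : s = 0 ∧ y = 0 := by
  have e : (((s, y), n * s + m * y) : Vars) = s • ((1, 0), n) + y • ((0, 1), m) := by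
    simp [mul_comm]
  rw [e, map_add, map_smul, map_smul] at h0
  have h1 := congrArg Prod.fst h0
  have h2 := congrArg Prod.snd h0
  simp only [Prod.fst_add, Prod.snd_add, Prod.smul_fst, Prod.smul_snd, smul_eq_mul,
    Prod.fst_zero, Prod.snd_zero] at h1 h2
  constructor
  · refine (mul_eq_zero.1 (?_ : s * _ = 0)).resolve_right h
    linear_combination (D ((0, 1), m)).1.2 * h1 - (D ((0, 1), m)).1.1 * h2
  · refine (mul_eq_zero.1 (?_ : y * _ = 0)).resolve_right h
    linear_combination (D ((1, 0), n)).1.1 * h2 - (D ((1, 0), n)).1.2 * h1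

/-- The new time does not depend on `x` and `u`. -/
lemma fderiv_t_eq_zero {φ : OpenPartialHomeomorph Vars Vars} (hφ : IsLocalDiffeo φ)
    {θ θ' : Coeffs} (hM : MapsEquation φ θ θ') {z : Vars} (hz : z ∈ φ.source) :
    (fderiv ℝ φ z ((0, 1), 0)).1.1 = 0 ∧ (fderiv ℝ φ z ((0, 0), 1)).1.1 = 0 := by
  have hsurj := hφ.fderiv_surjective hz
  have hal := fun m n => fderiv_t_along hφ hM hz (m := m) (n := n)
  generalize fderiv ℝ φ z = D at *
  obtain ⟨Tt, hTt⟩ : ∃ a, (D ((1, 0), 0)).1.1 = a := ⟨_, rfl⟩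
  obtain ⟨Tx, hTx⟩ : ∃ a, (D ((0, 1), 0)).1.1 = a := ⟨_, rfl⟩
  obtain ⟨Tu, hTu⟩ : ∃ a, (D ((0, 0), 1)).1.1 = a := ⟨_, rfl⟩
  obtain ⟨Xt, hXt⟩ : ∃ a, (D ((1, 0), 0)).1.2 = a := ⟨_, rfl⟩
  obtain ⟨Xx, hXx⟩ : ∃ a, (D ((0, 1), 0)).1.2 = a := ⟨_, rfl⟩
  obtain ⟨Xu, hXu⟩ : ∃ a, (D ((0, 0), 1)).1.2 = a := ⟨_, rfl⟩
  have hT : ∀ s y c, (D ((s, y), c)).1.1 = s * Tt + y * Tx + c * Tu := by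
    intro s y c
    rw [map_vars_eq]
    simp [hTt, hTx, hTu]
  have hX : ∀ s y c, (D ((s, y), c)).1.2 = s * Xt + y * Xx + c * Xu := by
    intro s y c
    rw [map_vars_eq]
    simp [hXt, hXx, hXu]
  rw [hTx, hTu]
  -- The expression is the Jacobian of the base map on a graph with slopes `n` and `m`; if it is
  -- nonzero, `fderiv_t_along` applies.
  have hprod : ∀ m n, Tx + m * Tu ≠ 0 →
      (Tt * Xx - Tx * Xt) + m * (Tt * Xu - Tu * Xt) + n * (Tu * Xx - Tx * Xu) = 0 := by
    intro m n hm
    by_contra hJ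
    have := hal m n (eq_zero_of_det_ne_zero (by
      rw [hT, hT, hX, hX]
      intro h0
      exact hJ (by linear_combination h0)))
    rw [hT] at this
    exact hm (by linear_combination this)
  by_contra hne
  -- A nonzero affine function of `m` has at most one root. Two good slopes are enough to annihilate
  -- all coefficients of the Jacobian, which is affine in `m` and `n`.
  have hroot : ∃ m₁ m₂ : ℝ, m₁ ≠ m₂ ∧ Tx + m₁ * Tu ≠ 0 ∧ Tx + m₂ * Tu ≠ 0 := by
    by_cases h0 : Tx = 0
    · have hu : Tu ≠ 0 := fun h => hne ⟨h0, h⟩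
      exact ⟨1, 2, by norm_num, by simpa [h0], by simpa [h0]⟩
    · by_cases h1 : Tx + 1 * Tu = 0
      · refine ⟨0, 2, by norm_num, by simpa, fun h2 => h0 (by linarith)⟩
      · exact ⟨0, 1, by norm_num, by simpa, h1⟩
  obtain ⟨m₁, m₂, hm, h1, h2⟩ := hroot
  have e1 := hprod m₁ 0 h1
  have e2 := hprod m₁ 1 h1
  have e3 := hprod m₂ 0 h2
  have f3 : Tu * Xx - Tx * Xu = 0 := by linear_combination e2 - e1
  have f2 : Tt * Xu - Tu * Xt = 0 :=
    mul_left_cancel₀ (sub_ne_zero.2 hm) (by linear_combination e1 - e3)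
  have f1 : Tt * Xx - Tx * Xt = 0 := by linear_combination e1 - m₁ * f2
  obtain ⟨⟨⟨s, y⟩, c⟩, he⟩ := hsurj ((1, 0), 0)
  obtain ⟨⟨⟨s', y'⟩, c'⟩, he'⟩ := hsurj ((0, 1), 0)
  have a1 := hT s y c
  have a2 := hX s y c
  have a3 := hT s' y' c'
  have a4 := hX s' y' c'
  rw [he] at a1 a2
  rw [he'] at a3 a4
  simp only at a1 a2 a3 a4
  -- Cauchy–Binet: the identity determinant is a combination of the `2 × 2` minors of `(T, X)`, all
  -- of which are zero.
  have : (1 : ℝ) = (s * y' - y * s') * (Tt * Xx - Tx * Xt) + (s * c' - c * s') * (Tt * Xu - Tu * Xt)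
      - (y * c' - c * y') * (Tu * Xx - Tx * Xu) := by
    linear_combination a1 * (s' * Xt + y' * Xx + c' * Xu) + a4 - a2 * (s' * Tt + y' * Tx + c' * Tu)
  rw [f1, f2, f3] at this
  norm_num at this

/-! ### Functions that are constant in some directions -/

lemma eq_of_fderiv_sub_eq_zero {E : Type*} [NormedAddCommGroup E] [NormedSpace ℝ E] {f : E → ℝ}
    {s : Set E} (hs : Convex ℝ s) (hf : ∀ w ∈ s, DifferentiableAt ℝ f w) {w w' : E} (hw : w ∈ s)
    (hw' : w' ∈ s) (h0 : ∀ x ∈ s, fderiv ℝ f x (w' - w) = 0) : f w' = f w := by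
  obtain ⟨x, hx, h⟩ := domain_mvt (fun w hw => (hf w hw).hasFDerivAt.hasFDerivWithinAt) hs hw hw'
  rw [h0 x (hs.segment_subset hw hw' hx)] at h
  exact sub_eq_zero.1 h

lemma fderiv_eq_of_translate {E F : Type*} [NormedAddCommGroup E] [NormedSpace ℝ E]
    [NormedAddCommGroup F] [NormedSpace ℝ F] {f : E → F} {w w' : E}
    (h : ∀ᶠ x in 𝓝 w, f (x + (w' - w)) = f x) : fderiv ℝ f w' = fderiv ℝ f w := by
  have h1 : fderiv ℝ (fun x => f (x + (w' - w))) w = fderiv ℝ f w := EventuallyEq.fderiv_eq h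
  rw [fderiv_comp_add_right, add_sub_cancel] at h1
  exact h1

namespace IsLocalDiffeo

variable {φ : OpenPartialHomeomorph Vars Vars}

/-- The new time as a function of the old variables. -/
lemma hasFDerivAt_t (hφ : IsLocalDiffeo φ) {z : Vars} (hz : z ∈ φ.source) :
    HasFDerivAt (fun w => (φ w).1.1) ((ContinuousLinearMap.fst ℝ ℝ ℝ).comp
      ((ContinuousLinearMap.fst ℝ Base ℝ).comp (fderiv ℝ φ z))) z :=
  (hφ.hasFDerivAt hz).fst.fst

lemma hasFDerivAt_x (hφ : IsLocalDiffeo φ) {z : Vars} (hz : z ∈ φ.source) :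
    HasFDerivAt (fun w => (φ w).1.2) ((ContinuousLinearMap.snd ℝ ℝ ℝ).comp
      ((ContinuousLinearMap.fst ℝ Base ℝ).comp (fderiv ℝ φ z))) z :=
  (hφ.hasFDerivAt hz).fst.snd

lemma hasFDerivAt_u (hφ : IsLocalDiffeo φ) {z : Vars} (hz : z ∈ φ.source) :
    HasFDerivAt (fun w => (φ w).2) ((ContinuousLinearMap.snd ℝ Base ℝ).comp (fderiv ℝ φ z)) z :=
  (hφ.hasFDerivAt hz).snd

lemma fderiv_t (hφ : IsLocalDiffeo φ) {z : Vars} (hz : z ∈ φ.source) (e : Vars) :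
    fderiv ℝ (fun w => (φ w).1.1) z e = (fderiv ℝ φ z e).1.1 := by
  rw [(hφ.hasFDerivAt_t hz).fderiv]; rfl

lemma fderiv_x (hφ : IsLocalDiffeo φ) {z : Vars} (hz : z ∈ φ.source) (e : Vars) :
    fderiv ℝ (fun w => (φ w).1.2) z e = (fderiv ℝ φ z e).1.2 := by
  rw [(hφ.hasFDerivAt_x hz).fderiv]; rfl

end IsLocalDiffeo

/-! ### The new independent variables -/

section IndependentVariables

variable {φ : OpenPartialHomeomorph Vars Vars} {θ θ' : Coeffs}

lemma t_eq_on_ball (hφ : IsLocalDiffeo φ) (hM : MapsEquation φ θ θ') {z w w' : Vars} {ε : ℝ}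
    (hball : Metric.ball z ε ⊆ φ.source) (hw : w ∈ Metric.ball z ε) (hw' : w' ∈ Metric.ball z ε)
    (h : w.1.1 = w'.1.1) : (φ w').1.1 = (φ w).1.1 := by
  refine eq_of_fderiv_sub_eq_zero (f := fun w => (φ w).1.1) (convex_ball z ε)
    (fun x hx => (hφ.hasFDerivAt_t (hball hx)).differentiableAt) hw hw' fun x hx => ?_
  obtain ⟨h1, h2⟩ := fderiv_t_eq_zero hφ hM (hball hx)
  have e : w' - w = ((0, w'.1.2 - w.1.2), w'.2 - w.2) := by
    refine Prod.ext (Prod.ext ?_ rfl) rfl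
    simp [h]
  rw [hφ.fderiv_t (hball hx), e, map_vars_eq]
  simp [h1, h2]

lemma fderiv_t_ne_zero (hφ : IsLocalDiffeo φ) (hM : MapsEquation φ θ θ') {z : Vars}
    (hz : z ∈ φ.source) : (fderiv ℝ φ z ((1, 0), 0)).1.1 ≠ 0 := by
  intro h0
  obtain ⟨h1, h2⟩ := fderiv_t_eq_zero hφ hM hz
  obtain ⟨⟨⟨s, y⟩, c⟩, he⟩ := hφ.fderiv_surjective hz ((1, 0), 0)
  rw [map_vars_eq] at he
  have := congrArg (fun w : Vars => w.1.1) he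
  simp [h0, h1, h2] at this

/-- Near `z`, `T` depends only on `t`, and `T_t ≠ 0`. Hence lines of constant new time come exactly,
not just to first order, from lines of constant old time. -/
lemma t_locally_injective (hφ : IsLocalDiffeo φ) (hM : MapsEquation φ θ θ') {z : Vars}
    (hz : z ∈ φ.source) : ∀ᶠ w in 𝓝 z, (φ w).1.1 = (φ z).1.1 → w.1.1 = z.1.1 := by
  obtain ⟨ε, hε, hball⟩ := Metric.isOpen_iff.1 φ.open_source z hz
  have hd : HasDerivAt (fun s => (φ ((s, z.1.2), z.2)).1.1) (fderiv ℝ φ z ((1, 0), 0)).1.1 z.1.1 :=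
    HasFDerivAt.comp_hasDerivAt (f := fun s : ℝ => (((s, z.1.2), z.2) : Vars)) z.1.1
      (hφ.hasFDerivAt_t hz)
      (((hasDerivAt_id _).prodMk (hasDerivAt_const _ _)).prodMk (hasDerivAt_const _ _))
  have hne := hd.eventually_ne (c := (φ z).1.1) (fderiv_t_ne_zero hφ hM hz)
  rw [eventually_nhdsWithin_iff] at hne
  have hc : Tendsto (fun w : Vars => w.1.1) (𝓝 z) (𝓝 z.1.1) :=
    (by fun_prop : Continuous fun w : Vars => w.1.1).tendsto z
  have hc' : Tendsto (fun w : Vars => (((w.1.1, z.1.2), z.2) : Vars)) (𝓝 z) (𝓝 z) :=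
    (by fun_prop : Continuous fun w : Vars => (((w.1.1, z.1.2), z.2) : Vars)).tendsto' _ _ rfl
  filter_upwards [hc.eventually hne, Metric.ball_mem_nhds z hε,
    hc'.eventually (Metric.ball_mem_nhds z hε)] with w h1 h2 h3 h4
  by_contra h5
  refine h1 h5 ?_
  rw [← h4]
  exact t_eq_on_ball hφ hM hball h2 h3 rfl

/-- The perturbation `(t - t₀) - (x - x₀) ^ 5 / 120` yields `∂t/∂T = (∂x/∂X) ^ 5` for the inverse
base map; inverting the triangular derivative gives the claim. -/
lemma fderiv_x_along (hφ : IsLocalDiffeo φ) (hM : MapsEquation φ θ θ') {z : Vars}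
    (hz : z ∈ φ.source) {m : ℝ} (hm : (fderiv ℝ φ z ((0, 1), m)).1.2 ≠ 0) :
    (fderiv ℝ φ z ((1, 0), 0)).1.1 = (fderiv ℝ φ z ((0, 1), m)).1.2 ^ 5 := by
  obtain ⟨hTx, hTu⟩ := fderiv_t_eq_zero hφ hM hz
  have hTt := fderiv_t_ne_zero hφ hM hz
  have hT : ∀ s y c, (fderiv ℝ φ z ((s, y), c)).1.1 = s * (fderiv ℝ φ z ((1, 0), 0)).1.1 := by
    intro s y c
    rw [map_vars_eq]
    simp [hTx, hTu]
  have hinj : ∀ n s y, (fderiv ℝ φ z ((s, y), n * s + m * y)).1 = 0 → s = 0 ∧ y = 0 := by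
    intro n s y
    refine eq_zero_of_det_ne_zero ?_ s y
    rw [hT 1 0 n, hT 0 1 m]
    have := mul_ne_zero hTt hm
    simpa using this
  obtain ⟨g, hgq, ⟨G', hG', hg'⟩, ⟨f, hfc, hfz, hf⟩, hM'⟩ := perturbed_testFun hφ hM hz (e := 0)
    (hinj 0) (hinj 1) (c₅ := -(θ.2.2 * z.2 ^ 2 * m)) (by ring)
  set q := (φ z).1 with hq
  set a := ((G'.symm : Base →L[ℝ] Base) (1, 0)).1 with ha
  set b := ((G'.symm : Base →L[ℝ] Base) (0, 1)).2 with hb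
  have ht₁ := (hasDerivAt_fst (hasDerivAt_add_t hg')).sub_const z.1.1
  have ht₂ := (hasDerivAt_snd (hasDerivAt_add_t hg')).sub_const z.1.2
  have hx := (hasDerivAt_snd (hasDerivAt_add_x hg')).sub_const z.1.2
  have hpow := ht₂.fun_pow 5
  have h5 := pow_five_isLittleO hx (by simp [hgq])
  have hgz : Tendsto (fun y => ((g (q.1, q.2 + y), f (g (q.1, q.2 + y))) : Vars)) (𝓝 0) (𝓝 z) := by
    have h1 : Tendsto g (𝓝 q) (𝓝 z.1) := by
      simpa [ContinuousAt, hgq] using hg'.continuousAt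
    have h2 : Tendsto f (𝓝 z.1) (𝓝 z.2) := by
      simpa [ContinuousAt, hfz] using hfc
    have h3 := h1.comp (tendsto_add_x q)
    exact h3.prodMk_nhds (h2.comp h3)
  -- The linear term in `t` must disappear to order five along the `X`-axis, so vanishing of its
  -- derivative alone would not be enough.
  have hline : ∀ᶠ y : ℝ in 𝓝 0, (g (q.1, q.2 + y)).1 = z.1.1 := by
    filter_upwards [hgz.eventually (t_locally_injective hφ hM hz),
      (tendsto_add_x q).eventually hf] with y h1 h2
    refine h1 ?_
    rw [h2]
  have key := hM' a (-b ^ 5 / 120) (by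
      have := (ht₁.fun_add ((hpow.const_mul (-1 / 120))))
      simpa [hgq, ha] using this) (by
      refine (h5.const_mul_left (-1 / 120)).congr' ?_ EventuallyEq.rfl
      filter_upwards [hline] with y hy
      rw [hy]
      simp only [hb]
      ring)
  have hab : a = b ^ 5 := by linarith
  have hs : G'.symm (1, 0) = (a, (G'.symm (1, 0)).2) := rfl
  have hy : G'.symm (0, 1) = ((G'.symm (0, 1)).1, b) := rfl
  have e1 : G' (a, (G'.symm (1, 0)).2) = (1, 0) := by rw [← hs, G'.apply_symm_apply]
  have e2 : G' ((G'.symm (0, 1)).1, b) = (0, 1) := by rw [← hy, G'.apply_symm_apply]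
  rw [hG'] at e1 e2
  have e3 := congrArg Prod.fst e1
  have e4 := congrArg Prod.fst e2
  have e5 := congrArg Prod.snd e2
  rw [hT] at e3 e4
  simp only at e3 e4
  have e6 := (mul_eq_zero.1 e4).resolve_right hTt
  rw [e6] at e5
  have e7 : (((0, b), (0 : ℝ) * 0 + m * b) : Vars) = b • ((0, 1), m) := by simp [mul_comm]
  rw [e7, map_smul] at e5
  have e8 : b * (fderiv ℝ φ z ((0, 1), m)).1.2 = 1 := e5
  have e9 : (b * (fderiv ℝ φ z ((0, 1), m)).1.2) ^ 5 = 1 := by rw [e8, one_pow]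
  have ha0 : a ≠ 0 := by
    rintro h0
    rw [h0] at e3
    simp at e3
  refine mul_left_cancel₀ ha0 ?_
  rw [e3, hab, ← mul_pow, e9]

/-- The new space variable does not depend on `u`, and it scales according to the time. -/
lemma fderiv_x_eq (hφ : IsLocalDiffeo φ) (hM : MapsEquation φ θ θ') {z : Vars}
    (hz : z ∈ φ.source) : (fderiv ℝ φ z ((0, 0), 1)).1.2 = 0 ∧
      (fderiv ℝ φ z ((1, 0), 0)).1.1 = (fderiv ℝ φ z ((0, 1), 0)).1.2 ^ 5 ∧
      (fderiv ℝ φ z ((0, 1), 0)).1.2 ≠ 0 := by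
  have hal := fun m => fderiv_x_along hφ hM hz (m := m)
  obtain ⟨hTx, hTu⟩ := fderiv_t_eq_zero hφ hM hz
  have hTt := fderiv_t_ne_zero hφ hM hz
  have hX : ∀ m, (fderiv ℝ φ z ((0, 1), m)).1.2 =
      (fderiv ℝ φ z ((0, 1), 0)).1.2 + m * (fderiv ℝ φ z ((0, 0), 1)).1.2 := by
    intro m
    rw [map_vars_eq]
    simp
  have hu : (fderiv ℝ φ z ((0, 0), 1)).1.2 = 0 := by
    by_contra hu
    -- If `X_u ≠ 0`, then `X_x + m X_u` takes every value as `m` varies, and `T_t` would equal both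
    -- `1 ^ 5` and `2 ^ 5`.
    have h1 : ∀ c : ℝ, c ≠ 0 → (fderiv ℝ φ z ((1, 0), 0)).1.1 = c ^ 5 := by
      intro c hc
      have h2 := hX ((c - (fderiv ℝ φ z ((0, 1), 0)).1.2) / (fderiv ℝ φ z ((0, 0), 1)).1.2)
      rw [div_mul_cancel₀ _ hu, add_sub_cancel] at h2
      have h3 := hal ((c - (fderiv ℝ φ z ((0, 1), 0)).1.2) / (fderiv ℝ φ z ((0, 0), 1)).1.2)
      rw [h2] at h3
      exact h3 hc
    have h2 := h1 1 (by norm_num)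
    have h3 := h1 2 (by norm_num)
    rw [h2] at h3
    norm_num at h3
  have hne : (fderiv ℝ φ z ((0, 1), 0)).1.2 ≠ 0 := by
    intro h0
    obtain ⟨⟨⟨s, y⟩, c⟩, he⟩ := hφ.fderiv_surjective hz ((0, 1), 0)
    rw [map_vars_eq] at he
    have e1 : s * (fderiv ℝ φ z ((1, 0), 0)).1.1 + y * (fderiv ℝ φ z ((0, 1), 0)).1.1 +
      c * (fderiv ℝ φ z ((0, 0), 1)).1.1 = 0 := congrArg (fun w : Vars => w.1.1) he
    have e2 : s * (fderiv ℝ φ z ((1, 0), 0)).1.2 + y * (fderiv ℝ φ z ((0, 1), 0)).1.2 +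
      c * (fderiv ℝ φ z ((0, 0), 1)).1.2 = 1 := congrArg (fun w : Vars => w.1.2) he
    rw [hTx, hTu, mul_zero, mul_zero, add_zero, add_zero] at e1
    rw [h0, hu, (mul_eq_zero.1 e1).resolve_right hTt] at e2
    norm_num at e2
  exact ⟨hu, hal 0 hne, hne⟩

end IndependentVariables

/-! ### The new time and space variables along the lines of constant time -/

/-- The function is locally invariant under translation by `w' - w`, hence so is its derivative;
this avoids interchanging second derivatives. -/
lemma fderiv_eq_of_fderiv_sub_eq_zero {E : Type*} [NormedAddCommGroup E] [NormedSpace ℝ E]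
    {f : E → ℝ} {s : Set E} (hs : Convex ℝ s) (ho : IsOpen s)
    (hf : ∀ w ∈ s, DifferentiableAt ℝ f w) {w w' : E} (hw : w ∈ s)
    (hw' : w' ∈ s) (h0 : ∀ x ∈ s, fderiv ℝ f x (w' - w) = 0) : fderiv ℝ f w' = fderiv ℝ f w := by
  refine fderiv_eq_of_translate ?_
  have hc : Tendsto (fun x => x + (w' - w)) (𝓝 w) (𝓝 w') :=
    (by fun_prop : Continuous fun x => x + (w' - w)).tendsto' _ _ (by simp)
  filter_upwards [ho.mem_nhds hw, hc.eventually (ho.mem_nhds hw')] with x h1 h2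
  exact eq_of_fderiv_sub_eq_zero hs hf h1 h2 fun y hy => by simpa using h0 y hy

section DependentVariable

variable {φ : OpenPartialHomeomorph Vars Vars} {θ θ' : Coeffs}

/-- `T_t` depends only on `t`, and `X_x` is its unique real fifth root. -/
lemma slope_eq_on_ball (hφ : IsLocalDiffeo φ) (hM : MapsEquation φ θ θ') {z w w' : Vars} {ε : ℝ}
    (hball : Metric.ball z ε ⊆ φ.source) (hw : w ∈ Metric.ball z ε) (hw' : w' ∈ Metric.ball z ε)
    (h : w.1.1 = w'.1.1) :
    (fderiv ℝ φ w' ((0, 1), 0)).1.2 = (fderiv ℝ φ w ((0, 1), 0)).1.2 := by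
  have h5 : (fderiv ℝ φ w' ((1, 0), 0)).1.1 = (fderiv ℝ φ w ((1, 0), 0)).1.1 := by
    rw [← hφ.fderiv_t (hball hw'), ← hφ.fderiv_t (hball hw)]
    refine DFunLike.congr_fun ?_ _
    refine fderiv_eq_of_fderiv_sub_eq_zero (convex_ball z ε) Metric.isOpen_ball
      (fun x hx => (hφ.hasFDerivAt_t (hball hx)).differentiableAt) hw hw' fun x hx => ?_
    obtain ⟨h1, h2⟩ := fderiv_t_eq_zero hφ hM (hball hx)
    have e : w' - w = ((0, w'.1.2 - w.1.2), w'.2 - w.2) := by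
      refine Prod.ext (Prod.ext ?_ rfl) rfl
      simp [h]
    rw [hφ.fderiv_t (hball hx), e, map_vars_eq]
    simp [h1, h2]
  rw [(fderiv_x_eq hφ hM (hball hw)).2.1, (fderiv_x_eq hφ hM (hball hw')).2.1] at h5
  exact (Odd.strictMono_pow (by decide : Odd 5)).injective h5

lemma x_eq_on_ball (hφ : IsLocalDiffeo φ) (hM : MapsEquation φ θ θ') {z w : Vars} {ε : ℝ}
    (hball : Metric.ball z ε ⊆ φ.source) (hw : w ∈ Metric.ball z ε) (h : w.1.1 = z.1.1) :
    (φ w).1.2 = (φ z).1.2 + (fderiv ℝ φ z ((0, 1), 0)).1.2 * (w.1.2 - z.1.2) := by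
  have hz : z ∈ Metric.ball z ε := Metric.mem_ball_self (Metric.pos_of_mem_ball hw)
  have hd : ∀ x ∈ φ.source, HasFDerivAt
      (fun x : Vars => (φ x).1.2 - (fderiv ℝ φ z ((0, 1), 0)).1.2 * x.1.2) _ x := fun x hx =>
    (hφ.hasFDerivAt_x hx).fun_sub ((((ContinuousLinearMap.snd ℝ ℝ ℝ).comp
      (ContinuousLinearMap.fst ℝ Base ℝ)).hasFDerivAt (x := x)).const_mul _)
  have hconv : Convex ℝ (Metric.ball z ε ∩ {x : Vars | x.1.1 = z.1.1}) :=
    (convex_ball z ε).inter (convex_hyperplane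
      (((LinearMap.fst ℝ ℝ ℝ).comp (LinearMap.fst ℝ Base ℝ)).isLinear) _)
  have := eq_of_fderiv_sub_eq_zero (w := z) (w' := w) hconv
    (fun x hx => (hd x (hball hx.1)).differentiableAt) ⟨hz, rfl⟩ ⟨hw, h⟩ fun x hx => by
      rw [(hd x (hball hx.1)).fderiv]
      have e : w - z = ((0, w.1.2 - z.1.2), w.2 - z.2) := by
        refine Prod.ext (Prod.ext ?_ rfl) rfl
        simp [h]
      change (fderiv ℝ φ x (w - z)).1.2 - (fderiv ℝ φ z ((0, 1), 0)).1.2 * (w.1.2 - z.1.2) = 0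
      rw [e, map_vars_eq]
      simp [(fderiv_x_eq hφ hM (hball hx.1)).1, mul_comm,
        slope_eq_on_ball hφ hM hball hz hx.1 hx.2.symm]
  linear_combination this

/-- The Jacobian of the base map is now `T_t X_x ≠ 0` for all slopes, so every test function has a
transformed germ. -/
lemma transversal (hφ : IsLocalDiffeo φ) (hM : MapsEquation φ θ θ') {z : Vars}
    (hz : z ∈ φ.source) (n m s y : ℝ) (h : (fderiv ℝ φ z ((s, y), n * s + m * y)).1 = 0) :
    s = 0 ∧ y = 0 := by
  obtain ⟨hTx, hTu⟩ := fderiv_t_eq_zero hφ hM hz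
  obtain ⟨hXu, -, hXx⟩ := fderiv_x_eq hφ hM hz
  refine eq_zero_of_det_ne_zero ?_ s y h
  have := mul_ne_zero (fderiv_t_ne_zero hφ hM hz) hXx
  rw [map_vars_eq _ 1 0 n, map_vars_eq _ 0 1 m]
  simpa [hTx, hTu, hXu] using this

/-! ### The new dependent variable -/

lemma exists_transformsGerm_testFun (hφ : IsLocalDiffeo φ) (hM : MapsEquation φ θ θ') {z : Vars}
    (hz : z ∈ φ.source) (n : ℝ) {c : Fin 6 → ℝ} (hc : c 0 = z.2) :
    ∃ v, TransformsGerm φ (testFun z.1 n 0 c) z.1 v (φ z).1 ∧ v (φ z).1 = (φ z).2 := by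
  have hup : testFun z.1 n 0 c z.1 = z.2 := (testFun_self _ _ _ _).trans hc
  obtain ⟨v, g, hv, -⟩ := exists_transformsGerm hφ
    (contDiff_testFun z.1 n 0 c).contDiffAt (by rwa [hup]) (by
      rintro ⟨s, y⟩ hr
      rw [hup, fderiv_testFun] at hr
      exact Prod.ext_iff.2 (transversal hφ hM hz _ _ s y hr))
  rw [hup] at hv
  refine ⟨v, hv, ?_⟩
  have := hv.map_point
  rw [hup] at this
  exact (congrArg Prod.snd this).symm

/-- The values of a transformed germ along the line of constant time. -/
lemma TransformsGerm.eventually_line (hφ : IsLocalDiffeo φ) (hM : MapsEquation φ θ θ')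
    {u v : Base → ℝ} {z : Vars} (hz : z ∈ φ.source)
    (h : TransformsGerm φ u z.1 v (φ z).1) (hu : u z.1 = z.2) :
    ∀ᶠ y in 𝓝 0, v ((φ z).1.1, (φ z).1.2 + (fderiv ℝ φ z ((0, 1), 0)).1.2 * y) =
      (φ ((z.1.1, z.1.2 + y), u (z.1.1, z.1.2 + y))).2 := by
  obtain ⟨ε, hε, hball⟩ := Metric.isOpen_iff.1 φ.open_source z hz
  have hc : Tendsto (fun r => ((r, u r) : Vars)) (𝓝 z.1) (𝓝 z) := by
    have : ContinuousAt (fun r => ((r, u r) : Vars)) z.1 :=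
      continuousAt_id.prodMk h.smooth_left.continuousAt
    simpa [ContinuousAt, hu] using this
  filter_upwards [(tendsto_add_x z.1).eventually h.map_graph,
    (hc.comp (tendsto_add_x z.1)).eventually (Metric.ball_mem_nhds z hε)] with y h1 h2
  rw [← h1]
  congr 1
  refine Prod.ext ?_ ?_
  · exact (t_eq_on_ball hφ hM hball (Metric.mem_ball_self hε) h2 rfl).symm
  · have := x_eq_on_ball hφ hM hball h2 rfl
    simp only [Function.comp_apply, add_sub_cancel_left] at this
    exact this.symm

/-- The transformation of the time derivative. -/
lemma TransformsGerm.dt_eq (hφ : IsLocalDiffeo φ) (hM : MapsEquation φ θ θ')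
    {n : ℝ} {c : Fin 6 → ℝ} {v : Base → ℝ} {z : Vars} (hz : z ∈ φ.source) (hc : c 0 = z.2)
    (h : TransformsGerm φ (testFun z.1 n 0 c) z.1 v (φ z).1) :
    (fderiv ℝ φ z ((0, 1), 0)).1.2 ^ 5 * dt v (φ z).1 +
      (fderiv ℝ φ z ((1, 0), 0)).1.2 * dx 1 v (φ z).1 =
      (fderiv ℝ φ z ((1, 0), 0)).2 + n * (fderiv ℝ φ z ((0, 0), 1)).2 := by
  obtain ⟨hTx, hTu⟩ := fderiv_t_eq_zero hφ hM hz
  obtain ⟨hXu, hT, hXx⟩ := fderiv_x_eq hφ hM hz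
  have hup : testFun z.1 n 0 c z.1 = z.2 := (testFun_self _ _ _ _).trans hc
  have := h.fderiv_eq hφ (1, 0)
  rw [hup, fderiv_testFun] at this
  have e : fderiv ℝ φ z ((1, 0), n * 1 + c 1 * 0) =
      fderiv ℝ φ z ((1, 0), 0) + n • fderiv ℝ φ z ((0, 0), 1) := by
    rw [map_vars_eq]
    simp
  have e' : (fderiv ℝ φ z ((1, 0), n * 1 + c 1 * 0)).1 =
      ((fderiv ℝ φ z ((0, 1), 0)).1.2 ^ 5, (fderiv ℝ φ z ((1, 0), 0)).1.2) := by
    rw [e]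
    refine Prod.ext ?_ ?_
    · simp [hTu, hT]
    · simp [hXu]
  simp only at this
  rw [e', fderiv_eq_dt_dx h.smooth_right, e] at this
  simpa using this

lemma exists_u_sub_eq (hφ : IsLocalDiffeo φ) {z : Vars} {ε : ℝ}
    (hball : Metric.ball z ε ⊆ φ.source) {r : Base} {a b : ℝ} (ha : (r, a) ∈ Metric.ball z ε)
    (hb : (r, b) ∈ Metric.ball z ε) : ∃ τ ∈ Set.Icc (0 : ℝ) 1,
      (r, a + τ * (b - a)) ∈ Metric.ball z ε ∧
      (φ (r, b)).2 - (φ (r, a)).2 = (fderiv ℝ φ (r, a + τ * (b - a)) ((0, 0), 1)).2 * (b - a) := by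
  obtain ⟨x, hx, h⟩ := domain_mvt (f := fun w => (φ w).2)
    (fun w hw => (hφ.hasFDerivAt_u (hball hw)).hasFDerivWithinAt) (convex_ball z ε) ha hb
  have hxb := (convex_ball z ε).segment_subset ha hb hx
  obtain ⟨τ, hτ, rfl⟩ := (segment_eq_image' ℝ _ _).subset hx
  have e : (((r, a) : Vars) + τ • (((r, b) : Vars) - (r, a))) = (r, a + τ * (b - a)) := by
    simp
  simp only [e] at hxb h
  refine ⟨τ, hτ, hxb, h.trans ?_⟩
  have e2 : ((r, b) : Vars) - (r, a) = (b - a) • ((0, 0), 1) := by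
    simp
    rfl
  rw [e2, map_smul]
  exact mul_comm _ _

lemma differentiableAt_fderiv_u (hφ : IsLocalDiffeo φ) {z : Vars} (hz : z ∈ φ.source) :
    DifferentiableAt ℝ (fun w => (fderiv ℝ φ w ((0, 0), 1)).2) z := by
  have h1 : ContDiffAt ℝ 1 (fderiv ℝ φ) z :=
    (contDiffAt_infty.1 (hφ.contDiffAt hz) 2).fderiv_right one_add_one_eq_two.le
  exact ((h1.differentiableAt (by simp)).clm_apply (differentiableAt_const _)).snd

/-- The expansion of a transformed germ along the line of constant time. -/
lemma isLittleO_of_line {F : ℝ → ℝ} {β a₃ a₄ a₅ : ℝ} (hβ : β ≠ 0)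
    (h : (fun y => F (β * y) - (a₃ * y ^ 3 + a₄ * y ^ 4 + a₅ * y ^ 5)) =o[𝓝 0] fun y : ℝ => y ^ 5) :
    (fun y => F y - (a₃ / β ^ 3 * y ^ 3 + a₄ / β ^ 4 * y ^ 4 + a₅ / β ^ 5 * y ^ 5))
      =o[𝓝 0] fun y : ℝ => y ^ 5 := by
  have hc : Tendsto (fun y : ℝ => β⁻¹ * y) (𝓝 0) (𝓝 0) :=
    (by fun_prop : Continuous fun y : ℝ => β⁻¹ * y).tendsto' _ _ (by simp)
  have hO : ((fun y : ℝ => y ^ 5) ∘ fun y => β⁻¹ * y) =O[𝓝 0] fun y : ℝ => y ^ 5 := by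
    refine ((isBigO_refl (fun y : ℝ => y ^ 5) (𝓝 0)).const_mul_left (β⁻¹ ^ 5)).congr_left
      fun y => ?_
    simp only [Function.comp_apply]
    ring
  refine ((h.comp_tendsto hc).trans_isBigO hO).congr_left fun y => ?_
  simp only [Function.comp_apply, mul_inv_cancel_left₀ hβ]
  field_simp

lemma fderiv_u_ne_zero (hφ : IsLocalDiffeo φ) (hM : MapsEquation φ θ θ') {z : Vars}
    (hz : z ∈ φ.source) : (fderiv ℝ φ z ((0, 0), 1)).2 ≠ 0 := by
  intro h0
  obtain ⟨hTx, hTu⟩ := fderiv_t_eq_zero hφ hM hz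
  obtain ⟨hXu, -, hXx⟩ := fderiv_x_eq hφ hM hz
  have hTt := fderiv_t_ne_zero hφ hM hz
  have h1 : fderiv ℝ φ z ((0, 0), 1) = 0 := Prod.ext (Prod.ext hTu hXu) h0
  obtain ⟨⟨⟨s, y⟩, c⟩, he⟩ := hφ.fderiv_surjective hz ((0, 0), 1)
  rw [map_vars_eq, h1, smul_zero, add_zero] at he
  have e1 : s * (fderiv ℝ φ z ((1, 0), 0)).1.1 + y * (fderiv ℝ φ z ((0, 1), 0)).1.1 = 0 :=
    congrArg (fun w : Vars => w.1.1) he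
  have e2 : s * (fderiv ℝ φ z ((1, 0), 0)).1.2 + y * (fderiv ℝ φ z ((0, 1), 0)).1.2 = 0 :=
    congrArg (fun w : Vars => w.1.2) he
  have e3 : s * (fderiv ℝ φ z ((1, 0), 0)).2 + y * (fderiv ℝ φ z ((0, 1), 0)).2 = 1 :=
    congrArg (fun w : Vars => w.2) he
  rw [hTx, mul_zero, add_zero] at e1
  have hs := (mul_eq_zero.1 e1).resolve_right hTt
  rw [hs, zero_mul, zero_add] at e2 e3
  rw [(mul_eq_zero.1 e2).resolve_right hXx, zero_mul] at e3
  norm_num at e3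

lemma tendsto_graph_line {u : Base → ℝ} {z : Vars} (hu : ContinuousAt u z.1) (h : u z.1 = z.2) :
    Tendsto (fun y : ℝ => (((z.1.1, z.1.2 + y), u (z.1.1, z.1.2 + y)) : Vars)) (𝓝 0) (𝓝 z) := by
  have hc : Tendsto (fun r => ((r, u r) : Vars)) (𝓝 z.1) (𝓝 z) := by
    have : ContinuousAt (fun r => ((r, u r) : Vars)) z.1 := continuousAt_id.prodMk hu
    simpa [ContinuousAt, h] using this
  exact hc.comp (tendsto_add_x z.1)

/-- The difference of two transformed germs along the line of constant time. -/
lemma TransformsGerm.exists_line_sub (hφ : IsLocalDiffeo φ) (hM : MapsEquation φ θ θ')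
    {u v u₁ v₁ : Base → ℝ} {z : Vars} {ε : ℝ} (hε : 0 < ε) (hball : Metric.ball z ε ⊆ φ.source)
    (h : TransformsGerm φ u z.1 v (φ z).1) (hu : u z.1 = z.2)
    (h₁ : TransformsGerm φ u₁ z.1 v₁ (φ z).1) (hu₁ : u₁ z.1 = z.2) :
    ∃ τ : ℝ → ℝ, (∀ y, τ y ∈ Set.Icc 0 1) ∧ ∀ᶠ y in 𝓝 0,
      ((z.1.1, z.1.2 + y), u (z.1.1, z.1.2 + y) +
        τ y * (u₁ (z.1.1, z.1.2 + y) - u (z.1.1, z.1.2 + y))) ∈ Metric.ball z ε ∧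
      v₁ ((φ z).1.1, (φ z).1.2 + (fderiv ℝ φ z ((0, 1), 0)).1.2 * y) -
        v ((φ z).1.1, (φ z).1.2 + (fderiv ℝ φ z ((0, 1), 0)).1.2 * y) =
      (fderiv ℝ φ ((z.1.1, z.1.2 + y), u (z.1.1, z.1.2 + y) +
        τ y * (u₁ (z.1.1, z.1.2 + y) - u (z.1.1, z.1.2 + y))) ((0, 0), 1)).2 *
        (u₁ (z.1.1, z.1.2 + y) - u (z.1.1, z.1.2 + y)) := by
  have hz := hball (Metric.mem_ball_self hε)
  have hex : ∀ y, ∃ τ : ℝ, τ ∈ Set.Icc 0 1 ∧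
      (((z.1.1, z.1.2 + y), u (z.1.1, z.1.2 + y)) ∈ Metric.ball z ε →
        ((z.1.1, z.1.2 + y), u₁ (z.1.1, z.1.2 + y)) ∈ Metric.ball z ε →
        ((z.1.1, z.1.2 + y), u (z.1.1, z.1.2 + y) +
        τ * (u₁ (z.1.1, z.1.2 + y) - u (z.1.1, z.1.2 + y))) ∈ Metric.ball z ε ∧
        (φ ((z.1.1, z.1.2 + y), u₁ (z.1.1, z.1.2 + y))).2 -
          (φ ((z.1.1, z.1.2 + y), u (z.1.1, z.1.2 + y))).2 =
        (fderiv ℝ φ ((z.1.1, z.1.2 + y), u (z.1.1, z.1.2 + y) +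
          τ * (u₁ (z.1.1, z.1.2 + y) - u (z.1.1, z.1.2 + y))) ((0, 0), 1)).2 *
          (u₁ (z.1.1, z.1.2 + y) - u (z.1.1, z.1.2 + y))) := by
    intro y
    by_cases hy : ((z.1.1, z.1.2 + y), u (z.1.1, z.1.2 + y)) ∈ Metric.ball z ε ∧
        ((z.1.1, z.1.2 + y), u₁ (z.1.1, z.1.2 + y)) ∈ Metric.ball z ε
    · obtain ⟨τ, hτ, hτ'⟩ := exists_u_sub_eq hφ hball hy.1 hy.2
      exact ⟨τ, hτ, fun _ _ => hτ'⟩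
    -- A filler off the ball, where nothing is claimed; only small `y` matter.
    · exact ⟨0, by simp, fun h1 h2 => (hy ⟨h1, h2⟩).elim⟩
  choose τ hτ hτ' using hex
  refine ⟨τ, hτ, ?_⟩
  filter_upwards [h.eventually_line hφ hM hz hu, h₁.eventually_line hφ hM hz hu₁,
    (tendsto_graph_line h.smooth_left.continuousAt hu).eventually (Metric.ball_mem_nhds z hε),
    (tendsto_graph_line h₁.smooth_left.continuousAt hu₁).eventually (Metric.ball_mem_nhds z hε)]
    with y e1 e2 e3 e4
  rw [e1, e2]
  exact hτ' y e3 e4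

/-- The derivative of the new dependent variable with respect to `u` is constant along the lines
of constant time. -/
lemma fderiv_fderiv_u_along (hφ : IsLocalDiffeo φ) (hM : MapsEquation φ θ θ') {z : Vars}
    (hz : z ∈ φ.source) (m : ℝ) :
    fderiv ℝ (fun w => (fderiv ℝ φ w ((0, 0), 1)).2) z ((0, 1), m) = 0 := by
  obtain ⟨ε, hε, hball⟩ := Metric.isOpen_iff.1 φ.open_source z hz
  obtain ⟨-, -, hβ⟩ := fderiv_x_eq hφ hM hz
  set c₅ := -(θ.2.2 * z.2 ^ 2 * m) with hc₅
  obtain ⟨v, hv, -⟩ := exists_transformsGerm_testFun hφ hM hz 0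
    (c := ![z.2, m, 0, 0, 0, c₅]) rfl
  -- The functions differ by `x ^ 4 / 24`, which the source equation does not see.
  obtain ⟨v₁, hv₁, -⟩ := exists_transformsGerm_testFun hφ hM hz 0
    (c := ![z.2, m, 0, 0, 1, c₅]) rfl
  have hs : SatisfiesAt θ' v _ := (hM _ _ _ _ hv).1 ((satisfiesAt_testFun _ _ _ _ _).2 (by
    simp [hc₅]))
  have hs₁ : SatisfiesAt θ' v₁ _ := (hM _ _ _ _ hv₁).1 ((satisfiesAt_testFun _ _ _ _ _).2 (by
    simp [hc₅]))
  obtain ⟨τ, hτ, hF⟩ := hv.exists_line_sub hφ hM hε hball (testFun_self _ _ _ _) hv₁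
    (testFun_self _ _ _ _)
  set β := (fderiv ℝ φ z ((0, 1), 0)).1.2 with hβdef
  set V := fun w => (fderiv ℝ φ w ((0, 0), 1)).2 with hV
  set q := (φ z).1 with hq
  set η : ℝ → Vars := fun y => ((z.1.1, z.1.2 + y), z.2 + m * y + c₅ / 120 * y ^ 5 +
    τ y * (1 / 24 * y ^ 4)) with hη
  have hη0 : η 0 = z := by simp [hη]
  -- The mean value parameter `τ` need not be continuous; being bounded, it is harmless next to `y ^
  -- 4`.
  have hτd : HasDerivAt (fun y => τ y * (1 / 24 * y ^ 4)) 0 0 := by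
    rw [hasDerivAt_iff_isLittleO]
    have hO : (fun y => τ y * (1 / 24 * y ^ 4)) =O[𝓝 0] fun y : ℝ => y ^ 4 := by
      refine IsBigO.of_bound 1 (Eventually.of_forall fun y => ?_)
      rw [norm_mul, norm_mul, Real.norm_of_nonneg (hτ y).1, ← mul_assoc]
      refine mul_le_mul_of_nonneg_right ?_ (norm_nonneg _)
      have := (hτ y).2
      norm_num
      linarith
    simpa using hO.trans_isLittleO (isLittleO_pow_id (by norm_num : 1 < 4))
  have hηd : HasDerivAt η ((0, 1), m) 0 := by
    refine ((hasDerivAt_const _ _).prodMk ((hasDerivAt_id _).const_add _)).prodMk ?_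
    have h1 := ((hasDerivAt_id (0 : ℝ)).const_mul m).const_add z.2
    have h2 := ((hasDerivAt_id (0 : ℝ)).fun_pow 5).const_mul (c₅ / 120)
    simpa using (h1.fun_add h2).fun_add hτd
  have hVd : HasDerivAt (fun y => V (η y)) (fderiv ℝ V z ((0, 1), m)) 0 := by
    have : HasFDerivAt V (fderiv ℝ V z) (η 0) := by
      rw [hη0]
      exact (differentiableAt_fderiv_u hφ hz).hasFDerivAt
    exact this.comp_hasDerivAt 0 hηd
  have hVo : (fun y => V (η y) - V z - fderiv ℝ V z ((0, 1), m) * y) =o[𝓝 0] fun y : ℝ => y := by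
    have := hVd.isLittleO
    simpa [hη0, mul_comm] using this
  -- The image of `x ^ 4 / 24` carries the factor `U_u`, whose first-order variation along the graph
  -- is the coefficient of `y ^ 5`. That coefficient must vanish, as the time derivatives agree.
  have hexp := isLittleO_of_line (F := fun Y => v₁ (q.1, q.2 + Y) - v (q.1, q.2 + Y)) hβ (a₃ := 0)
    (a₄ := V z / 24) (a₅ := fderiv ℝ V z ((0, 1), m) / 24) (by
      have h4 := hVo.mul_isBigO (isBigO_refl (fun y : ℝ => 1 / 24 * y ^ 4) (𝓝 0))
      have h5 : (fun y : ℝ => y * (1 / 24 * y ^ 4)) =O[𝓝 0] fun y : ℝ => y ^ 5 :=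
        ((isBigO_refl (fun y : ℝ => y ^ 5) (𝓝 0)).const_mul_left (1 / 24)).congr_left
          fun y => by ring
      refine (h4.trans_isBigO h5).congr' ?_ EventuallyEq.rfl
      filter_upwards [hF] with y hy
      have e := hy.2
      have e1 : testFun z.1 0 0 ![z.2, m, 0, 0, 1, c₅] (z.1.1, z.1.2 + y) -
          testFun z.1 0 0 ![z.2, m, 0, 0, 0, c₅] (z.1.1, z.1.2 + y) = 1 / 24 * y ^ 4 := by
        simp [testFun]
      have e2 : testFun z.1 0 0 ![z.2, m, 0, 0, 0, c₅] (z.1.1, z.1.2 + y) =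
          z.2 + m * y + c₅ / 120 * y ^ 5 := by
        simp [testFun]
      rw [e1, e2] at e
      have e3 : v₁ (q.1, q.2 + β * y) - v (q.1, q.2 + β * y) = V (η y) * (1 / 24 * y ^ 4) := e
      rw [e3]
      ring)
  obtain ⟨h1, h2⟩ := hs.sub_eq_zero hv.smooth_right hv₁.smooth_right hs₁ hexp
  have d1 := hv.dt_eq hφ hM hz rfl
  have d2 := hv₁.dt_eq hφ hM hz rfl
  rw [← hβdef, ← hq] at d1 d2
  rw [h2] at d2
  have d3 : dt v₁ q = dt v q :=
    mul_left_cancel₀ (pow_ne_zero 5 hβ) (by linear_combination d2 - d1)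
  rw [d3] at h1
  field_simp at h1
  linarith

lemma fderiv_u_eq_on_ball (hφ : IsLocalDiffeo φ) (hM : MapsEquation φ θ θ') {z w w' : Vars} {ε : ℝ}
    (hball : Metric.ball z ε ⊆ φ.source) (hw : w ∈ Metric.ball z ε) (hw' : w' ∈ Metric.ball z ε)
    (h : w.1.1 = w'.1.1) :
    (fderiv ℝ φ w' ((0, 0), 1)).2 = (fderiv ℝ φ w ((0, 0), 1)).2 := by
  refine eq_of_fderiv_sub_eq_zero (f := fun w => (fderiv ℝ φ w ((0, 0), 1)).2) (convex_ball z ε)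
    (fun x hx => differentiableAt_fderiv_u hφ (hball hx)) hw hw' fun x hx => ?_
  -- The slopes `m = 0` and `m = 1` span all directions of constant time.
  have e : w' - w = (w'.1.2 - w.1.2) • (((0, 1), 0) : Vars) + (w'.2 - w.2) • ((0, 1), 1) -
      (w'.2 - w.2) • ((0, 1), 0) := by
    refine Prod.ext (Prod.ext ?_ ?_) ?_ <;> simp [h]
  rw [e, map_sub, map_add, map_smul, map_smul, map_smul, fderiv_fderiv_u_along hφ hM (hball hx),
    fderiv_fderiv_u_along hφ hM (hball hx)]
  simp

/-- The new dependent variable is proportional to the old one. -/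
lemma u_eq (hφ : IsLocalDiffeo φ) (hM : MapsEquation φ θ θ') {z : Vars} (hz : z ∈ φ.source) :
    θ'.1 * (fderiv ℝ φ z ((0, 1), 0)).1.2 ^ 2 * (φ z).2 = θ.1 * z.2 := by
  obtain ⟨ε, hε, hball⟩ := Metric.isOpen_iff.1 φ.open_source z hz
  obtain ⟨-, -, hβ⟩ := fderiv_x_eq hφ hM hz
  have hV := fderiv_u_ne_zero hφ hM hz
  obtain ⟨v, hv, hvq⟩ := exists_transformsGerm_testFun hφ hM hz 0
    (c := ![z.2, 0, 0, 0, 0, 0]) rfl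
  -- The value of `u_t` compensates `A u u_xxx` for the added cubic `x ^ 3 / 6`.
  obtain ⟨v₁, hv₁, -⟩ := exists_transformsGerm_testFun hφ hM hz (-(θ.1 * z.2))
    (c := ![z.2, 0, 0, 1, 0, 0]) rfl
  have hs : SatisfiesAt θ' v _ := (hM _ _ _ _ hv).1 ((satisfiesAt_testFun _ _ _ _ _).2 (by
    simp))
  have hs₁ : SatisfiesAt θ' v₁ _ := (hM _ _ _ _ hv₁).1 ((satisfiesAt_testFun _ _ _ _ _).2 (by
    simp))
  obtain ⟨τ, hτ, hF⟩ := hv.exists_line_sub hφ hM hε hball (testFun_self _ _ _ _) hv₁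
    (testFun_self _ _ _ _)
  set β := (fderiv ℝ φ z ((0, 1), 0)).1.2 with hβdef
  set q := (φ z).1 with hq
  have hexp := isLittleO_of_line (F := fun Y => v₁ (q.1, q.2 + Y) - v (q.1, q.2 + Y)) hβ
    (a₃ := (fderiv ℝ φ z ((0, 0), 1)).2 / 6) (a₄ := 0) (a₅ := 0) (by
      refine (isLittleO_zero _ _).congr' ?_ EventuallyEq.rfl
      filter_upwards [hF] with y hy
      have e := hy.2
      rw [fderiv_u_eq_on_ball hφ hM hball (Metric.mem_ball_self hε) hy.1 rfl] at e
      rw [e]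
      simp [testFun]
      ring)
  obtain ⟨h1, h2⟩ := hs.sub_eq_zero hv.smooth_right hv₁.smooth_right hs₁ hexp
  have d1 := hv.dt_eq hφ hM hz rfl
  have d2 := hv₁.dt_eq hφ hM hz rfl
  rw [← hβdef, ← hq] at d1 d2
  rw [h2] at d2
  rw [hvq] at h1
  refine mul_left_cancel₀ hV ?_
  field_simp at h1
  have hβ2 : β ^ 2 * (dt v₁ q - dt v q) * β ^ 3 = -(θ.1 * z.2) * (fderiv ℝ φ z ((0, 0), 1)).2 := by
    linear_combination d2 - d1
  linear_combination h1 - hβ2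

/-- The relations that are detected by quadratic polynomials in `x`. -/
lemma coeff_relation (hφ : IsLocalDiffeo φ) (hM : MapsEquation φ θ θ') (hθ : θ ∈ arbitraryElements)
    (hθ' : θ' ∈ arbitraryElements) {z : Vars} (hz : z ∈ φ.source) :
    θ.2.1 * θ'.1 = θ'.2.1 * θ.1 ∧
    θ'.1 ^ 2 * (fderiv ℝ φ z ((1, 0), 0)).1.2 = (fderiv ℝ φ z ((0, 1), 0)).1.2 * z.2 ^ 2 *
      (θ'.2.2 * θ.1 ^ 2 - θ.2.2 * θ'.1 ^ 2) := by
  obtain ⟨ε, hε, hball⟩ := Metric.isOpen_iff.1 φ.open_source z hz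
  obtain ⟨-, -, hβ⟩ := fderiv_x_eq hφ hM hz
  have hz' := Metric.mem_ball_self (x := z) hε
  set β := (fderiv ℝ φ z ((0, 1), 0)).1.2 with hβdef
  set q := (φ z).1 with hq
  -- By `u_eq`, `a` is the ratio of `U` to `u` on the slice of constant time through `z`.
  obtain ⟨a, ha⟩ : ∃ a, a = θ.1 / (θ'.1 * β ^ 2) := ⟨_, rfl⟩
  have hA' := hθ'.1
  have ha' : θ'.1 * β ^ 2 * a = θ.1 := by
    rw [ha]; field_simp
  have ha0 : a ≠ 0 := by
    rintro rfl
    exact hθ.1 (by rw [← ha', mul_zero])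
  have hline : ∀ w ∈ Metric.ball z ε, w.1.1 = z.1.1 → (φ w).2 = a * w.2 := by
    intro w hw h
    have h1 := u_eq hφ hM (hball hw)
    rw [slope_eq_on_ball hφ hM hball hz' hw h.symm, ← hβdef, ← ha'] at h1
    exact mul_left_cancel₀ (mul_ne_zero hA' (pow_ne_zero 2 hβ)) (by linear_combination h1)
  have hV : (fderiv ℝ φ z ((0, 0), 1)).2 = a := by
    have h1 : HasDerivAt (fun c : ℝ => (φ (z.1, c)).2) (fderiv ℝ φ z ((0, 0), 1)).2 z.2 :=
      HasFDerivAt.comp_hasDerivAt (f := fun c : ℝ => ((z.1, c) : Vars)) z.2 (hφ.hasFDerivAt_u hz)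
        ((hasDerivAt_const _ _).prodMk (hasDerivAt_id _))
    have h2 : HasDerivAt (fun c : ℝ => (φ (z.1, c)).2) (a * 1) z.2 := by
      refine ((hasDerivAt_id z.2).const_mul a).congr_of_eventuallyEq ?_
      have hc : Tendsto (fun c : ℝ => ((z.1, c) : Vars)) (𝓝 z.2) (𝓝 z) :=
        (by fun_prop : Continuous fun c : ℝ => ((z.1, c) : Vars)).tendsto' _ _ rfl
      filter_upwards [hc.eventually (Metric.ball_mem_nhds z hε)] with c hc using hline _ hc rfl
    simpa using h1.unique h2
  have hrel : ∀ c₁ c₂ : ℝ,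
      (fderiv ℝ φ z ((1, 0), 0)).2 + -(θ.2.1 * c₁ * c₂ + θ.2.2 * z.2 ^ 2 * c₁) * a =
        -β ^ 5 * (θ'.2.1 * (a * c₁ / β) * (a * c₂ / β ^ 2) +
          θ'.2.2 * (a * z.2) ^ 2 * (a * c₁ / β)) +
        (fderiv ℝ φ z ((1, 0), 0)).1.2 * (a * c₁ / β) := by
    intro c₁ c₂
    obtain ⟨v, hv, hvq⟩ := exists_transformsGerm_testFun hφ hM hz
      (-(θ.2.1 * c₁ * c₂ + θ.2.2 * z.2 ^ 2 * c₁)) (c := ![z.2, c₁, c₂, 0, 0, 0]) rfl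
    have hs : SatisfiesAt θ' v _ := (hM _ _ _ _ hv).1 ((satisfiesAt_testFun _ _ _ _ _).2 (by
      simp))
    have d1 := hv.dt_eq hφ hM hz rfl
    rw [← hβdef, hV] at d1
    have hc : Tendsto (fun y : ℝ => β⁻¹ * y) (𝓝 0) (𝓝 0) :=
      (by fun_prop : Continuous fun y : ℝ => β⁻¹ * y).tendsto' _ _ (by simp)
    have hdx := dx_eq_of_isLittleO hv.smooth_right
      (a := ![a * z.2, a * c₁ / β, a * c₂ / β ^ 2 / 2, 0, 0, 0]) (by
        refine (isLittleO_zero _ _).congr' ?_ EventuallyEq.rfl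
        filter_upwards [hc.eventually (hv.eventually_line hφ hM hz (testFun_self _ _ _ _)),
          ((tendsto_graph_line hv.smooth_left.continuousAt
            (testFun_self _ _ _ _)).comp hc).eventually (Metric.ball_mem_nhds z hε)] with y h1 h2
        have h3 := hline _ h2 rfl
        simp only [Function.comp_apply] at h3
        rw [h3, ← hβdef, mul_inv_cancel_left₀ hβ] at h1
        rw [h1]
        simp [testFun, Fin.sum_univ_six]
        field_simp
        ring)
    have x1 := hdx 1
    have x2 := hdx 2
    have x3 := hdx 3
    have x5 := hdx 5
    simp [Nat.factorial] at x1 x2 x3 x5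
    unfold SatisfiesAt at hs
    rw [x1, x2, x3, x5, hvq, hline z hz' rfl] at hs
    rw [x1] at d1
    linear_combination -d1 + β ^ 5 * hs
  -- The relation is polynomial in `c₁`, `c₂`: `r0` carries only `U_t`, subtracting it from `r1`
  -- isolates `X_t`, and `r1 - r2` isolates the `B` terms.
  have r0 := hrel 0 0
  have r1 := hrel 1 0
  have r2 := hrel 1 1
  field_simp at r0 r1 r2
  have e1 : θ.2.1 = θ'.2.1 * a * β ^ 2 :=
    mul_left_cancel₀ (mul_ne_zero ha0 hβ) (by linear_combination r1 - r2)
  have e2 : (fderiv ℝ φ z ((1, 0), 0)).1.2 =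
      β * z.2 ^ 2 * (θ'.2.2 * a ^ 2 * β ^ 4 - θ.2.2) :=
    mul_left_cancel₀ ha0 (by linear_combination r0 - r1)
  constructor
  · rw [e1, ← ha']; ring
  · rw [e2, ← ha']; ring

end DependentVariable

/-! ### Classification of the admissible transformations -/

section Classification

variable {φ : OpenPartialHomeomorph Vars Vars} {θ θ' : Coeffs}

/-- `coeff_relation` makes `X_t` a multiple of `u ^ 2`, while `X_u = 0` makes it independent of `u`;
hence the multiplier is zero. -/
lemma coeff_relation_cubic (hφ : IsLocalDiffeo φ) (hM : MapsEquation φ θ θ')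
    (hθ : θ ∈ arbitraryElements) (hθ' : θ' ∈ arbitraryElements) {z : Vars} (hz : z ∈ φ.source) :
    θ'.2.2 * θ.1 ^ 2 - θ.2.2 * θ'.1 ^ 2 = 0 := by
  obtain ⟨ε, hε, hball⟩ := Metric.isOpen_iff.1 φ.open_source z hz
  have hz' := Metric.mem_ball_self (x := z) hε
  obtain ⟨-, -, hβ⟩ := fderiv_x_eq hφ hM hz
  have hrel : ∀ h : ℝ, |h| < ε → (h * (2 * z.2 + h)) *
      (θ'.2.2 * θ.1 ^ 2 - θ.2.2 * θ'.1 ^ 2) = 0 := by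
    intro h hh
    have hw : (z.1, z.2 + h) ∈ Metric.ball z ε := by
      rw [Metric.mem_ball, dist_eq_norm]
      simpa [Prod.norm_def] using hh
    have h1 := (coeff_relation hφ hM hθ hθ' hz).2
    have h2 := (coeff_relation hφ hM hθ hθ' (hball hw)).2
    rw [slope_eq_on_ball hφ hM hball hz' hw rfl] at h2
    have h3 : (fderiv ℝ φ (z.1, z.2 + h) ((1, 0), 0)).1.2 = (fderiv ℝ φ z ((1, 0), 0)).1.2 := by
      rw [← hφ.fderiv_x (hball hw), ← hφ.fderiv_x hz]
      refine DFunLike.congr_fun ?_ _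
      refine fderiv_eq_of_fderiv_sub_eq_zero (convex_ball z ε) Metric.isOpen_ball
        (fun x hx => (hφ.hasFDerivAt_x (hball hx)).differentiableAt) hz' hw fun x hx => ?_
      have e : ((z.1, z.2 + h) : Vars) - z = ((0, 0), h) := by
        refine Prod.ext (Prod.ext ?_ ?_) ?_ <;> simp
      rw [hφ.fderiv_x (hball hx), e, map_vars_eq]
      simp [(fderiv_x_eq hφ hM (hball hx)).1]
    rw [h3, h1] at h2
    exact mul_left_cancel₀ hβ (by linear_combination -h2)
  have hε2 : |ε / 2| < ε := by rw [abs_of_pos (by linarith)]; linarith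
  -- Adding the relations for opposite shifts cancels the part linear in the shift and leaves the
  -- nonzero factor `ε ^ 2 / 2`.
  have r1 := hrel (ε / 2) hε2
  have r2 := hrel (-(ε / 2)) (by rwa [abs_neg])
  have hsq : ε ^ 2 / 2 ≠ 0 := by positivity
  exact mul_left_cancel₀ hsq (by linear_combination r1 + r2)

lemma fderiv_x_t_eq_zero (hφ : IsLocalDiffeo φ) (hM : MapsEquation φ θ θ')
    (hθ : θ ∈ arbitraryElements) (hθ' : θ' ∈ arbitraryElements) {z : Vars} (hz : z ∈ φ.source) :
    (fderiv ℝ φ z ((1, 0), 0)).1.2 = 0 := by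
  have h1 := (coeff_relation hφ hM hθ hθ' hz).2
  rw [coeff_relation_cubic hφ hM hθ hθ' hz, mul_zero] at h1
  exact (mul_eq_zero.1 h1).resolve_left (pow_ne_zero 2 hθ'.1)

/-- Move first in `x` and `u` at fixed `t`, then in `t` alone; along the second leg `X_t = 0`, so
`X` and its derivative are unchanged. -/
lemma slope_eq_of_mem_ball (hφ : IsLocalDiffeo φ) (hM : MapsEquation φ θ θ')
    (hθ : θ ∈ arbitraryElements) (hθ' : θ' ∈ arbitraryElements) {z w : Vars} {ε : ℝ}
    (hball : Metric.ball z ε ⊆ φ.source) (hw : w ∈ Metric.ball z ε) :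
    (fderiv ℝ φ w ((0, 1), 0)).1.2 = (fderiv ℝ φ z ((0, 1), 0)).1.2 := by
  have hz' := Metric.mem_ball_self (x := z) (Metric.pos_of_mem_ball hw)
  have hw' : ((z.1.1, w.1.2), w.2) ∈ Metric.ball z ε := by
    rw [Metric.mem_ball, Prod.dist_eq, Prod.dist_eq] at hw ⊢
    have h1 := Metric.pos_of_mem_ball hz'
    simp only [max_lt_iff, dist_self] at hw ⊢
    exact ⟨⟨h1, hw.1.2⟩, hw.2⟩
  rw [← slope_eq_on_ball hφ hM hball hz' hw' rfl, ← hφ.fderiv_x (hball hw),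
    ← hφ.fderiv_x (hball hw')]
  refine DFunLike.congr_fun ?_ _
  refine fderiv_eq_of_fderiv_sub_eq_zero (convex_ball z ε) Metric.isOpen_ball
    (fun x hx => (hφ.hasFDerivAt_x (hball hx)).differentiableAt) hw' hw fun x hx => ?_
  have e : w - ((z.1.1, w.1.2), w.2) = ((w.1.1 - z.1.1, 0), 0) := by
    refine Prod.ext (Prod.ext ?_ ?_) ?_ <;> simp
  rw [hφ.fderiv_x (hball hx), e, map_vars_eq]
  simp [fderiv_x_t_eq_zero hφ hM hθ hθ' (hball hx)]

/-- By connectedness the locally constant `X_x` is one number `β`. Then `T - β ^ 5 t` and `X - β x`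
have zero derivative, which supplies `δ` and `γ`, while `u_eq` fixes `U` with `l = A' / A`. -/
theorem exists_scaling_of_mapsEquation
    (hφ : IsPointTransformation φ) (hθ : θ ∈ arbitraryElements) (hθ' : θ' ∈ arbitraryElements)
    (hM : MapsEquation φ θ θ') :
    ∃ β γ δ l : ℝ, β ≠ 0 ∧ l ≠ 0 ∧ Set.EqOn φ (varScaling β γ δ l) φ.source ∧
      θ' = coeffScaling l θ := by
  obtain ⟨hφ, hconn⟩ := hφ
  obtain ⟨z₀, hz₀⟩ := hconn.nonempty
  have hpre := hconn.isPreconnected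
  set β := (fderiv ℝ φ z₀ ((0, 1), 0)).1.2 with hβdef
  have hβ : β ≠ 0 := (fderiv_x_eq hφ hM hz₀).2.2
  have hslope : ∀ z ∈ φ.source, (fderiv ℝ φ z ((0, 1), 0)).1.2 = β := by
    intro z hz
    refine (hpre.induction₂ (fun a b => (fderiv ℝ φ a ((0, 1), 0)).1.2 =
      (fderiv ℝ φ b ((0, 1), 0)).1.2) ?_ ?_ ?_ hz₀ hz).symm
    · intro x hx
      obtain ⟨ε, hε, hball⟩ := Metric.isOpen_iff.1 φ.open_source x hx
      filter_upwards [mem_nhdsWithin_of_mem_nhds (Metric.ball_mem_nhds x hε)] with y hy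
      exact (slope_eq_of_mem_ball hφ hM hθ hθ' hball hy).symm
    · intro x y w _ _ _ h1 h2
      exact h1.trans h2
    · intro x y _ _ h
      exact h.symm
  have hT : ∀ z ∈ φ.source, HasFDerivAt (fun w : Vars => (φ w).1.1 - β ^ 5 * w.1.1)
      (0 : Vars →L[ℝ] ℝ) z := by
    intro z hz
    refine ((hφ.hasFDerivAt_t hz).fun_sub ((((ContinuousLinearMap.fst ℝ ℝ ℝ).comp
      (ContinuousLinearMap.fst ℝ Base ℝ)).hasFDerivAt (x := z)).const_mul (β ^ 5))).congr_fderiv ?_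
    obtain ⟨h1, h2⟩ := fderiv_t_eq_zero hφ hM hz
    obtain ⟨-, h3, -⟩ := fderiv_x_eq hφ hM hz
    rw [hslope z hz] at h3
    refine ContinuousLinearMap.ext fun e => ?_
    change (fderiv ℝ φ z ((e.1.1, e.1.2), e.2)).1.1 - β ^ 5 * e.1.1 = 0
    rw [map_vars_eq]
    simp [h1, h2, h3, mul_comm]
  have hX : ∀ z ∈ φ.source, HasFDerivAt (fun w : Vars => (φ w).1.2 - β * w.1.2)
      (0 : Vars →L[ℝ] ℝ) z := by
    intro z hz
    refine ((hφ.hasFDerivAt_x hz).fun_sub ((((ContinuousLinearMap.snd ℝ ℝ ℝ).comp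
      (ContinuousLinearMap.fst ℝ Base ℝ)).hasFDerivAt (x := z)).const_mul β)).congr_fderiv ?_
    obtain ⟨h1, -, -⟩ := fderiv_x_eq hφ hM hz
    refine ContinuousLinearMap.ext fun e => ?_
    change (fderiv ℝ φ z ((e.1.1, e.1.2), e.2)).1.2 - β * e.1.2 = 0
    rw [map_vars_eq]
    simp [h1, hslope z hz, fderiv_x_t_eq_zero hφ hM hθ hθ' hz, mul_comm]
  obtain ⟨δ, hδ⟩ := φ.open_source.exists_is_const_of_fderiv_eq_zero hpre
    (fun z hz => (hT z hz).differentiableAt.differentiableWithinAt) fun z hz => (hT z hz).fderiv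
  obtain ⟨γ, hγ⟩ := φ.open_source.exists_is_const_of_fderiv_eq_zero hpre
    (fun z hz => (hX z hz).differentiableAt.differentiableWithinAt) fun z hz => (hX z hz).fderiv
  have hA := hθ.1
  have hA' := hθ'.1
  refine ⟨β, γ, δ, θ'.1 / θ.1, hβ, div_ne_zero hA' hA, fun z hz => ?_, ?_⟩
  · refine Prod.ext (Prod.ext ?_ ?_) ?_ <;> simp only [varScaling]
    · linear_combination hδ z hz
    · linear_combination hγ z hz
    · have h1 := u_eq hφ hM hz
      rw [hslope z hz] at h1
      field_simp
      linear_combination h1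
  · have h1 := (coeff_relation hφ hM hθ hθ' hz₀).1
    have h2 := coeff_relation_cubic hφ hM hθ hθ' hz₀
    refine Prod.ext ?_ (Prod.ext ?_ ?_) <;> simp only [coeffScaling] <;> field_simp
    · linear_combination -h1
    · linear_combination h2

end Classification

/-! ### The equivalence group and the equivalence groupoid -/

/-- A homeomorphism between open sets that is a scaling is a local diffeomorphism. -/
lemma isLocalDiffeo_of_leftInvOn {V : Type*} [NormedAddCommGroup V] [NormedSpace ℝ V]
    {Φ : OpenPartialHomeomorph V V} {f g : V → V} (hf : ContDiff ℝ ∞ f) (hg : ContDiff ℝ ∞ g)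
    (hfg : ∀ z, g (f z) = z) (h : Set.EqOn Φ f Φ.source) : IsLocalDiffeo Φ where
  contDiffOn := hf.contDiffOn.congr h
  contDiffOn_symm := by
    refine hg.contDiffOn.congr fun z hz => ?_
    have h1 := h (Φ.map_target hz)
    rw [Φ.right_inv hz] at h1
    conv_rhs => rw [h1]
    rw [hfg]

/-- The transformations described by a scaling on a product domain. -/
def IsScalingOn (Ψ : OpenPartialHomeomorph (Vars × Coeffs) (Vars × Coeffs)) (Ω : Set Vars)
    (β γ δ l : ℝ) : Prop :=
  IsOpen Ω ∧ IsConnected Ω ∧ Ψ.source = Ω ×ˢ arbitraryElements ∧ β ≠ 0 ∧ l ≠ 0 ∧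
    Set.EqOn Ψ (scaling β γ δ l) Ψ.source

/-- The triple `(1, 1, 1)` determines the scaling of the variables. Every other triple gives a
scaling with the same action on the variables, hence the same `l`, so one formula holds for all
coefficients. -/
lemma IsUsualEquivalence.exists_isScalingOn
    {Ψ : OpenPartialHomeomorph (Vars × Coeffs) (Vars × Coeffs)} (h : IsUsualEquivalence Ψ) :
    ∃ Ω β γ δ l, IsScalingOn Ψ Ω β γ δ l := by
  obtain ⟨-, φ, hφ, hs, -, h1, h2⟩ := h
  obtain ⟨θ₁, hθ₁, -, hm⟩ := h2 _ one_mem_arbitraryElements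
  obtain ⟨β, γ, δ, l, hβ, hl, he, -⟩ :=
    exists_scaling_of_mapsEquation hφ one_mem_arbitraryElements hθ₁ hm
  refine ⟨φ.source, β, γ, δ, l, φ.open_source, hφ.isConnected_source, hs, hβ, hl, ?_⟩
  rintro ⟨z, θ⟩ hw
  have hw' := hw
  rw [hs] at hw'
  obtain ⟨hz, hθ⟩ : z ∈ φ.source ∧ θ ∈ arbitraryElements := hw'
  obtain ⟨θ', hθ', hc, hm⟩ := h2 θ hθ
  obtain ⟨β', γ', δ', l', hβ', hl', he', rfl⟩ := exists_scaling_of_mapsEquation hφ hθ hθ' hm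
  obtain ⟨-, -, -, rfl⟩ := varScaling_inj φ.open_source hφ.isConnected_source.nonempty hβ hl hl'
    (he.symm.trans he')
  rw [scaling_eq]
  exact Prod.ext ((h1 _ hw).trans (he hz)) (hc z hz)

lemma IsScalingOn.isUsualEquivalence
    {Ψ : OpenPartialHomeomorph (Vars × Coeffs) (Vars × Coeffs)} {Ω : Set Vars} {β γ δ l : ℝ}
    (h : IsScalingOn Ψ Ω β γ δ l) : IsUsualEquivalence Ψ := by
  obtain ⟨ho, hc, hs, hβ, hl, he⟩ := h
  have hinv : ∀ w, scaling β⁻¹ (-(β⁻¹ * γ)) (-(β⁻¹ ^ 5 * δ)) l⁻¹ (scaling β γ δ l w) = w := by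
    intro w
    rw [scaling_eq, scaling_eq, varScaling_left_inv hβ hl, coeffScaling_comp,
      inv_mul_cancel₀ hl, coeffScaling_one]
  refine ⟨isLocalDiffeo_of_leftInvOn (contDiff_scaling _ _ _ _) (contDiff_scaling _ _ _ _)
    hinv he, ?_⟩
  set e := varHomeomorph hβ hl γ δ
  set φ := e.toOpenPartialHomeomorphOfImageEq Ω ho (varScaling β γ δ l '' Ω) rfl with hφdef
  have hφ : Set.EqOn φ (varScaling β γ δ l) φ.source := fun z _ => rfl
  refine ⟨φ, ⟨isLocalDiffeo_of_leftInvOn (contDiff_varScaling _ _ _ _)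
    (contDiff_varScaling _ _ _ _) (varScaling_left_inv hβ hl γ δ) hφ, hc⟩, hs, ?_, ?_, ?_⟩
  · rw [← Ψ.image_source_eq_target, he.image_eq, hs, image_scaling_prod hl]
    rfl
  · intro w hw
    rw [he hw]
    rfl
  · intro θ hθ
    refine ⟨coeffScaling l θ, coeffScaling_mem hl hθ, fun z hz => ?_,
      mapsEquation_of_eqOn hβ hl hφ θ⟩
    have : (z, θ) ∈ Ψ.source := by rw [hs]; exact ⟨hz, hθ⟩
    rw [he this]
    rfl

/-- The scaling of the joint space with all values of the variables as its domain. -/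
lemma exists_isScalingOn_univ {β l : ℝ} (hβ : β ≠ 0) (hl : l ≠ 0) (γ δ : ℝ) :
    ∃ Ψ, IsScalingOn Ψ Set.univ β γ δ l :=
  ⟨((varHomeomorph hβ hl γ δ).prodCongr (coeffHomeomorph hl)).toOpenPartialHomeomorphOfImageEq
    (Set.univ ×ˢ arbitraryElements) (isOpen_univ.prod isOpen_arbitraryElements) _ rfl,
    isOpen_univ, isConnected_univ, rfl, hβ, hl, fun _ _ => rfl⟩

lemma IsScalingOn.symm {Ψ : OpenPartialHomeomorph (Vars × Coeffs) (Vars × Coeffs)}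
    {Ω : Set Vars} {β γ δ l : ℝ} (h : IsScalingOn Ψ Ω β γ δ l) :
    IsScalingOn Ψ.symm (varScaling β γ δ l '' Ω) β⁻¹ (-(β⁻¹ * γ)) (-(β⁻¹ ^ 5 * δ)) l⁻¹ := by
  obtain ⟨ho, hc, hs, hβ, hl, he⟩ := h
  refine ⟨(varHomeomorph hβ hl γ δ).isOpenMap Ω ho,
    hc.image _ (contDiff_varScaling _ _ _ _).continuous.continuousOn, ?_, inv_ne_zero hβ,
    inv_ne_zero hl, ?_⟩
  · rw [Ψ.symm_source, ← Ψ.image_source_eq_target, he.image_eq, hs, image_scaling_prod hl]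
  · intro w hw
    have h1 := he (Ψ.map_target hw)
    rw [Ψ.right_inv hw] at h1
    conv_rhs => rw [h1]
    rw [scaling_eq, scaling_eq, varScaling_left_inv hβ hl, coeffScaling_comp,
      inv_mul_cancel₀ hl, coeffScaling_one]

lemma IsScalingOn.trans {Ψ Ψ' : OpenPartialHomeomorph (Vars × Coeffs) (Vars × Coeffs)}
    {Ω Ω' : Set Vars} {β γ δ l β' γ' δ' l' : ℝ} (h : IsScalingOn Ψ Ω β γ δ l)
    (h' : IsScalingOn Ψ' Ω' β' γ' δ' l') (hΨ : Ψ.target = Ψ'.source) :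
    IsScalingOn (Ψ.trans Ψ') Ω (β' * β) (β' * γ + γ') (β' ^ 5 * δ + δ') (l' * l) := by
  obtain ⟨ho, hc, hs, hβ, hl, he⟩ := h
  obtain ⟨-, -, -, hβ', hl', he'⟩ := h'
  have hsrc : (Ψ.trans Ψ').source = Ψ.source := by
    rw [OpenPartialHomeomorph.trans_source, ← hΨ]
    exact Set.inter_eq_left.2 Ψ.mapsTo
  refine ⟨ho, hc, hsrc.trans hs, mul_ne_zero hβ' hβ, mul_ne_zero hl' hl, ?_⟩
  intro w hw
  rw [hsrc] at hw
  have h1 : Ψ w ∈ Ψ'.source := hΨ ▸ Ψ.map_source hw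
  rw [OpenPartialHomeomorph.coe_trans, Function.comp_apply, he' h1, he hw, scaling_eq,
    scaling_eq, scaling_eq, varScaling_comp, coeffScaling_comp]

end FifthKdV

/-! ### The main theorem -/

theorem corollary4 :
    -- the usual equivalence group consists of the indicated transformations
    (∀ Ψ : OpenPartialHomeomorph (FifthKdV.Vars × FifthKdV.Coeffs)
          (FifthKdV.Vars × FifthKdV.Coeffs),
        FifthKdV.IsUsualEquivalence Ψ ↔
          ∃ Ω : Set FifthKdV.Vars, IsOpen Ω ∧ IsConnected Ω ∧
            Ψ.source = Ω ×ˢ FifthKdV.arbitraryElements ∧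
            ∃ β γ δ l : ℝ, β ≠ 0 ∧ l ≠ 0 ∧
              Set.EqOn Ψ (FifthKdV.scaling β γ δ l) Ψ.source) ∧
    -- each of these transformations occurs, with all values of the variables as its domain
    (∀ β γ δ l : ℝ, β ≠ 0 → l ≠ 0 →
        ∃ Ψ : OpenPartialHomeomorph (FifthKdV.Vars × FifthKdV.Coeffs)
            (FifthKdV.Vars × FifthKdV.Coeffs),
          FifthKdV.IsUsualEquivalence Ψ ∧
          Ψ.source = Set.univ ×ˢ FifthKdV.arbitraryElements ∧
          Set.EqOn Ψ (FifthKdV.scaling β γ δ l) Ψ.source) ∧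
    -- they are closed under inversion and composition
    (∀ Ψ : OpenPartialHomeomorph (FifthKdV.Vars × FifthKdV.Coeffs)
          (FifthKdV.Vars × FifthKdV.Coeffs),
        FifthKdV.IsUsualEquivalence Ψ → FifthKdV.IsUsualEquivalence Ψ.symm) ∧
    (∀ Ψ Ψ' : OpenPartialHomeomorph (FifthKdV.Vars × FifthKdV.Coeffs)
          (FifthKdV.Vars × FifthKdV.Coeffs),
        FifthKdV.IsUsualEquivalence Ψ → FifthKdV.IsUsualEquivalence Ψ' →
          Ψ.target = Ψ'.source → FifthKdV.IsUsualEquivalence (Ψ.trans Ψ')) ∧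
    -- the group generates the whole equivalence groupoid
    (∀ (θ θ' : FifthKdV.Coeffs) (φ : OpenPartialHomeomorph FifthKdV.Vars FifthKdV.Vars),
        FifthKdV.IsAdmissible θ θ' φ ↔
          θ ∈ FifthKdV.arbitraryElements ∧ FifthKdV.IsPointTransformation φ ∧
            ∃ Ψ : OpenPartialHomeomorph (FifthKdV.Vars × FifthKdV.Coeffs)
                (FifthKdV.Vars × FifthKdV.Coeffs),
              FifthKdV.IsUsualEquivalence Ψ ∧ FifthKdV.IsInducedBy θ θ' φ Ψ) := by
  refine ⟨fun Ψ => ⟨fun h => ?_, ?_⟩, fun β γ δ l hβ hl => ?_, fun Ψ h => ?_,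
    fun Ψ Ψ' h h' hΨ => ?_, fun θ θ' φ => ⟨fun h => ?_, ?_⟩⟩
  · obtain ⟨Ω, β, γ, δ, l, ho, hc, hs, hβ, hl, he⟩ := h.exists_isScalingOn
    exact ⟨Ω, ho, hc, hs, β, γ, δ, l, hβ, hl, he⟩
  · rintro ⟨Ω, ho, hc, hs, β, γ, δ, l, hβ, hl, he⟩
    exact FifthKdV.IsScalingOn.isUsualEquivalence ⟨ho, hc, hs, hβ, hl, he⟩
  · obtain ⟨Ψ, hΨ⟩ := FifthKdV.exists_isScalingOn_univ hβ hl γ δ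
    exact ⟨Ψ, hΨ.isUsualEquivalence, hΨ.2.2.1, hΨ.2.2.2.2.2⟩
  · obtain ⟨Ω, β, γ, δ, l, hs⟩ := h.exists_isScalingOn
    exact hs.symm.isUsualEquivalence
  · obtain ⟨Ω, β, γ, δ, l, hs⟩ := h.exists_isScalingOn
    obtain ⟨Ω', β', γ', δ', l', hs'⟩ := h'.exists_isScalingOn
    exact (hs.trans hs' hΨ).isUsualEquivalence
  · obtain ⟨β, γ, δ, l, hβ, hl, he, rfl⟩ := FifthKdV.exists_scaling_of_mapsEquation
      h.isPointTransformation h.mem_left h.mem_right h.mapsEquation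
    -- The scaling on all of space serves as the inducing element, whatever the domain of `φ`.
    obtain ⟨Ψ, hΨ⟩ := FifthKdV.exists_isScalingOn_univ hβ hl γ δ
    have hsub : φ.source ×ˢ FifthKdV.arbitraryElements ⊆ Ψ.source := by
      rw [hΨ.2.2.1]
      exact Set.prod_mono (Set.subset_univ _) subset_rfl
    refine ⟨h.mem_left, h.isPointTransformation, Ψ, hΨ.isUsualEquivalence, hsub,
      fun z hz => ?_⟩
    rw [hΨ.2.2.2.2.2 (hsub ⟨hz, h.mem_left⟩), FifthKdV.scaling_eq, he hz]
  · rintro ⟨hθ, hφ, Ψ, hΨ, hsub, hind⟩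
    obtain ⟨Ω, β, γ, δ, l, -, -, -, hβ, hl, he⟩ := hΨ.exists_isScalingOn
    have hval : ∀ z ∈ φ.source,
        φ z = FifthKdV.varScaling β γ δ l z ∧ θ' = FifthKdV.coeffScaling l θ := by
      intro z hz
      have h1 := hind z hz
      rw [he (hsub ⟨hz, hθ⟩), FifthKdV.scaling_eq] at h1
      exact ⟨(congrArg Prod.fst h1).symm, (congrArg Prod.snd h1).symm⟩
    -- A point of the domain is needed to read off `θ'` from the inducing transformation.
    obtain ⟨z, hz⟩ := hφ.isConnected_source.nonempty
    obtain rfl := (hval z hz).2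
    exact ⟨hθ, FifthKdV.coeffScaling_mem hl hθ, hφ,
      FifthKdV.mapsEquation_of_eqOn hβ hl (fun z hz => (hval z hz).1) θ⟩
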